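/- **Proposition 4.3.** Let $X$ be a real-valued Lévy process under $\mathbb P$ with $X_0=0$ a.s. and càdlàg paths; $\mathbb E_x$ denotes expectation for $X$ started at $x$, i.e. for $x+X$. Let $K>0$, $r>0$, and $f(x)=(K-e^x)^+$. Fix an integer $n\ge 1$. Let $N$ be a Poisson process with intensity $n$, independent of $X$, and $T_k=\inf\{t\ge 0: N_t\ge k\}$ (so $T_0=0$). Let $\widetilde{\mathcal T}$ be the set of stopping times of the naturally enlarged (completed, right-continuous) filtration generated by $(X,N)$ that take values in $\{T_0,T_1,T_2,\dots\}$. For $\tau$ with values in this grid put $D(\tau)=\sum_{i\ge 0}\mathbf 1_{\{\tau=T_i\}}e^{-ri/n}$, and for $k\ge 0$ define $$V_k(x)=\sup_{\tau\in\widetilde{\mathcal T}}\mathbb E_x\big[D(\tau\wedge T_k)\,f(X_{\tau\wedge T_k})\big].$$ Let $\xi$ be exponentially distributed with mean $1/n$ and independent of $X$. Suppose that $\mathbb P(X_1<0)>0$, i.e. $X$ is not a subordinator. Then there is a sequence $(\bar x_k)_{k\ge 0}$ of real numbers with $\bar x_0=\log K$ which is strictly decreasing if $\mathbb P(X_1>0)>0$,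 and which satisfies $\bar x_0>\bar x_1=\bar x_2=\cdots$ if $\mathbb P(X_1>0)=0$ (i.e. if $-X$ is a subordinator), such that for each $k\ge 1$: (i) if $\mathbb P(X_1>0)>0$, then $\bar x_k$ is the unique solution on $(-\infty,\bar x_{k-1})$ of the equation in $z$ $$e^{-r/n}\,\mathbb E_z[V_{k-1}(X_\xi)]-f(z)=0 ;$$ if $\mathbb P(X_1>0)=0$, then $\bar x_k$ is the unique solution of this equation on $(-\infty,\log K)$; (ii) $V_k(x)=f(x)$ for $x\le\bar x_k$, and $V_k(x)=e^{-r/n}\,\mathbb E_x[V_{k-1}(X_\xi)]$ for $x>\bar x_k$; (iii) $V_k>V_{k-1}$ on $(\bar x_k,\infty)$. -/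

import Mathlib

open MeasureTheory ProbabilityTheory Filter Set
open scoped NNReal ENNReal Topology

/-- A real-valued Lévy process under `μ`, started at `0`: stationary independent increments and
paths that are right continuous with left limits. Under the law `ℙ_x` the process is `x + X`. -/
structure IsLevyProcess {Ω : Type*} [MeasurableSpace Ω] (X : ℝ≥0 → Ω → ℝ) (μ : Measure Ω) :
    Prop where
  measurable : ∀ t, Measurable (X t)
  zero : ∀ᵐ ω ∂μ, X 0 ω = 0
  indepIncrements : HasIndepIncrements X μ
  stationaryIncrements : ∀ s t : ℝ≥0,
    IdentDistrib (fun ω ↦ X (s + t) ω - X s ω) (fun ω ↦ X t ω - X 0 ω) μ μ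
  rightContinuous : ∀ ω t, ContinuousWithinAt (fun s ↦ X s ω) (Ici t) t
  leftLimits : ∀ ω t, ∃ l : ℝ, Tendsto (fun s ↦ X s ω) (𝓝[<] t) (𝓝 l)

/-- A Poisson process with intensity `q`, as a counting process. The paths are nondecreasing, so
the natural-number subtraction in the increments is the genuine one. -/
structure IsPoissonProcess {Ω : Type*} [MeasurableSpace Ω] (N : ℝ≥0 → Ω → ℕ) (q : ℝ≥0)
    (μ : Measure Ω) : Prop where
  measurable : ∀ t, Measurable (N t)
  zero : ∀ᵐ ω ∂μ, N 0 ω = 0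
  mono : ∀ ω, Monotone (fun t ↦ N t ω)
  indepIncrements : HasIndepIncrements N μ
  incrementLaw : ∀ s t : ℝ≥0, HasLaw (fun ω ↦ N (s + t) ω - N s ω) (poissonMeasure (q * t)) μ
  rightContinuous : ∀ ω t, ContinuousWithinAt (fun s ↦ N s ω) (Ici t) t

/-- `T_k = inf {t ≥ 0 | N_t ≥ k}`, with value `⊤` if the set is empty; in particular `T_0 = 0`. -/
noncomputable def jumpTime {Ω : Type*} (N : ℝ≥0 → Ω → ℕ) (k : ℕ) (ω : Ω) : WithTop ℝ≥0 :=
  ⨅ (t : ℝ≥0) (_ : k ≤ N t ω), (t : WithTop ℝ≥0)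

/-- The filtration generated by the pair `(X, N)`, where null sets have been added to every
σ-algebra. The σ-algebras need not lie below that of `Ω`, only below its `μ`-completion. -/
noncomputable def completedPairFiltration {Ω : Type*} [m : MeasurableSpace Ω] (μ : Measure Ω)
    (X : ℝ≥0 → Ω → ℝ) (N : ℝ≥0 → Ω → ℕ)
    (hX : ∀ t, Measurable (X t)) (hN : ∀ t, Measurable (N t)) :
    Filtration ℝ≥0 (eventuallyMeasurableSpace m (ae μ)) where
  seq t := eventuallyMeasurableSpace (⨆ s ≤ t,
    MeasurableSpace.comap (fun ω ↦ (X s ω, N s ω)) inferInstance) (ae μ)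
  mono' := by
    rintro i j hij A ⟨B, hB, hAB⟩
    have h : (⨆ s ≤ i, MeasurableSpace.comap (fun ω ↦ (X s ω, N s ω)) inferInstance) ≤
        ⨆ s ≤ j, MeasurableSpace.comap (fun ω ↦ (X s ω, N s ω)) inferInstance :=
      biSup_mono fun s hs ↦ le_trans hs hij
    exact ⟨B, h B hB, hAB⟩
  le' := by
    rintro i A ⟨B, hB, hAB⟩
    have h : (⨆ s ≤ i, MeasurableSpace.comap (fun ω ↦ (X s ω, N s ω)) inferInstance) ≤ m :=
      iSup₂_le fun s _ ↦ ((hX s).prodMk (hN s)).comap_le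
    exact ⟨B, h B hB, hAB⟩

/-- The naturally enlarged (completed and right-continuous) filtration of the pair `(X, N)`. -/
noncomputable def enlargedPairFiltration {Ω : Type*} [m : MeasurableSpace Ω] (μ : Measure Ω)
    (X : ℝ≥0 → Ω → ℝ) (N : ℝ≥0 → Ω → ℕ)
    (hX : ∀ t, Measurable (X t)) (hN : ∀ t, Measurable (N t)) :
    Filtration ℝ≥0 (eventuallyMeasurableSpace m (ae μ)) :=
  (completedPairFiltration μ X N hX hN).rightCont

/-- Stopping times of the enlarged filtration that only take values on the grid `T_0, T_1, …`. -/
def IsGridStoppingTime {Ω : Type*} [m : MeasurableSpace Ω] (μ : Measure Ω)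
    (X : ℝ≥0 → Ω → ℝ) (N : ℝ≥0 → Ω → ℕ)
    (hX : ∀ t, Measurable (X t)) (hN : ∀ t, Measurable (N t)) (τ : Ω → WithTop ℝ≥0) : Prop :=
  IsStoppingTime (enlargedPairFiltration μ X N hX hN) τ ∧ ∀ ω, ∃ i, τ ω = jumpTime N i ω

/-- The modified discount factor `D(τ) = ∑_{i ≥ 0} 1_{τ = T_i} e^{-r i / n}`. -/
noncomputable def gridDiscount {Ω : Type*} (N : ℝ≥0 → Ω → ℕ) (r : ℝ) (n : ℕ)
    (τ : Ω → WithTop ℝ≥0) (ω : Ω) : ℝ :=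
  ∑' i : ℕ, {ω' | τ ω' = jumpTime N i ω'}.indicator (fun _ ↦ Real.exp (-r * i / n)) ω

/-- `V_k(x) = sup_τ 𝔼_x[D(τ ∧ T_k) f(X_{τ ∧ T_k})]`, the supremum over the grid-valued stopping
times. -/
noncomputable def gridValue {Ω : Type*} [MeasurableSpace Ω] (μ : Measure Ω)
    (X : ℝ≥0 → Ω → ℝ) (N : ℝ≥0 → Ω → ℕ)
    (hX : ∀ t, Measurable (X t)) (hN : ∀ t, Measurable (N t))
    (r : ℝ) (n : ℕ) (f : ℝ → ℝ) (k : ℕ) (x : ℝ) : ℝ :=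
  sSup {v : ℝ | ∃ τ : Ω → WithTop ℝ≥0, IsGridStoppingTime μ X N hX hN τ ∧
    v = ∫ ω, gridDiscount N r n (fun ω' ↦ min (τ ω') (jumpTime N k ω')) ω *
      f (stoppedValue (fun t ω' ↦ x + X t ω') (fun ω' ↦ min (τ ω') (jumpTime N k ω')) ω) ∂μ}

/-- The discounted expectation `e^{-r/n} 𝔼_z[V(X_ξ)]`. -/
noncomputable def continuationValue {Ω : Type*} [MeasurableSpace Ω] (μ : Measure Ω)
    (X : ℝ≥0 → Ω → ℝ) (ξ : Ω → ℝ≥0) (r : ℝ) (n : ℕ) (V : ℝ → ℝ) (z : ℝ) : ℝ :=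
  Real.exp (-r / n) * ∫ ω, V (z + X (ξ ω) ω) ∂μ

/-- The payoff `(K - e^x)^+` of the put. -/
noncomputable def putPayoff (K x : ℝ) : ℝ := max (K - Real.exp x) 0

/-- `x` is the unique solution of `g z = 0` on `s`. -/
def IsUniqueZeroOn (g : ℝ → ℝ) (s : Set ℝ) (x : ℝ) : Prop :=
  x ∈ s ∧ g x = 0 ∧ ∀ z ∈ s, g z = 0 → z = x

/-! Sampled at the jump times of `N`, the process `x + X` is a random walk started at `x` whose step
law `ν` is the law of `X_ξ`: the waiting times are exponential and independent of `X`, and `X` has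
stationary independent increments. Stopping on the grid is therefore a discrete-time put problem
with discount factor `q = e^{-r/n}`, and `gridValue_eq_walkValue` identifies `V_k` with its backward
induction `walkValue`.

The delicate point is that the enlarged filtration knows more than the walk does. The strong Markov
property `setIntegral_arrivalTime_succ`, on the event that `τ` has not stopped by `T_j`, shows that
this information is worthless. Its proof approaches `T_j` from the right by dyadic times, which
reduces it to the independence of past and future at deterministic times. The verification argument
`integral_interpolatedPayoff` then bounds every rule by `walkValue`, and exercising as soon as
payoff and value agree attains the bound.

For the boundaries one uses the price `s = e^x`. Each value function is convex in `s`, hence so is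
the gap between continuing and receiving `K - s`. The gap is negative for small `s`, because values
are at most `K` and `q < 1`, and positive at `s = K`, because the walk can jump below any level. So
it has exactly one zero below `K` (`exists_boundary`). Strict growth of the values beyond each
boundary moves the next boundary down if upward steps have positive probability; without upward
steps the boundary cannot move after the first step (`exists_exercise_boundaries`). The facts about
`ν` that this needs are drawn from `X_1` by right continuity and the positivity of the exponential
density (`map_eval_pos`). -/

/-- The value functions of the discrete-time put problem for the random walk with step law `ν` and
discount factor `q`, by backward induction. -/
noncomputable def walkValue (ν : Measure ℝ) (q K : ℝ) : ℕ → ℝ → ℝ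
  | 0 => putPayoff K
  | k + 1 => fun x ↦ max (putPayoff K x) (q * ∫ u, walkValue ν q K k (x + u) ∂ν)

/-! ### The payoff and averages over translations -/

lemma putPayoff_nonneg (K x : ℝ) : 0 ≤ putPayoff K x := le_max_right _ _

lemma continuous_putPayoff (K : ℝ) : Continuous (putPayoff K) := by
  unfold putPayoff; fun_prop

lemma putPayoff_le {K : ℝ} (hK : 0 < K) (x : ℝ) : putPayoff K x ≤ K :=
  max_le (by linarith [Real.exp_pos x]) hK.le

lemma putPayoff_of_le {K x : ℝ} (hK : 0 < K) (hx : x ≤ Real.log K) :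
    putPayoff K x = K - Real.exp x :=
  max_eq_left (by linarith [(Real.le_log_iff_exp_le hK).1 hx])

lemma putPayoff_of_ge {K x : ℝ} (hK : 0 < K) (hx : Real.log K ≤ x) : putPayoff K x = 0 :=
  max_eq_right (by linarith [(Real.log_le_iff_le_exp hK).1 hx])

/-- Translation averages of bounded continuous functions are continuous. -/
lemma continuous_integral_add (ν : Measure ℝ) [IsProbabilityMeasure ν] {φ : ℝ → ℝ} {M : ℝ}
    (hφ : Continuous φ) (hM : ∀ x, |φ x| ≤ M) : Continuous fun x ↦ ∫ u, φ (x + u) ∂ν :=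
  continuous_of_dominated (bound := fun _ ↦ M)
    (fun x ↦ (by fun_prop : Continuous fun u ↦ φ (x + u)).aestronglyMeasurable)
    (fun x ↦ ae_of_all _ fun u ↦ hM _) (integrable_const _) (ae_of_all _ fun u ↦ by fun_prop)

lemma integrable_comp_add (ν : Measure ℝ) [IsProbabilityMeasure ν] {φ : ℝ → ℝ} {M : ℝ}
    (hφ : Continuous φ) (hM : ∀ x, |φ x| ≤ M) (x : ℝ) : Integrable (fun u ↦ φ (x + u)) ν :=
  Integrable.of_bound (by fun_prop : Continuous fun u ↦ φ (x + u)).aestronglyMeasurable M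
    (ae_of_all _ fun u ↦ hM _)

lemma putPayoff_le_walkValue (ν : Measure ℝ) (q K : ℝ) (k : ℕ) (x : ℝ) : putPayoff K x ≤ walkValue ν q K k x := by
  cases k with
  | zero => exact le_rfl
  | succ k => exact le_max_left _ _

lemma integral_lt_integral_of_lt_on {ν : Measure ℝ} {φ ψ : ℝ → ℝ} {s : Set ℝ}
    (hφ : Integrable φ ν) (hψ : Integrable ψ ν) (hle : ∀ u, φ u ≤ ψ u)
    (hlt : ∀ u ∈ s, φ u < ψ u) (hs : 0 < ν s) : ∫ u, φ u ∂ν < ∫ u, ψ u ∂ν := by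
  rw [← sub_pos, ← integral_sub hψ hφ, integral_pos_iff_support_of_nonneg
    (fun u ↦ sub_nonneg.2 (hle u)) (hψ.sub hφ)]
  exact hs.trans_le (measure_mono fun u hu ↦ (sub_pos.2 (hlt u hu)).ne')

/-! ### Values and exercise boundaries of the random-walk problem -/

section walkValue

variable {ν : Measure ℝ} [IsProbabilityMeasure ν] {q K : ℝ}

/-- Continuity and bounds go through one induction, since continuity of the averaged value comes
from dominated convergence with the bound of the previous level. -/
lemma walkValue_aux (hq0 : 0 < q) (hq1 : q < 1) (hK : 0 < K) (k : ℕ) :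
    Continuous (walkValue ν q K k) ∧ ∀ x, 0 ≤ walkValue ν q K k x ∧ walkValue ν q K k x ≤ K := by
  induction k with
  | zero => exact ⟨continuous_putPayoff K, fun x ↦ ⟨putPayoff_nonneg K x, putPayoff_le hK x⟩⟩
  | succ k ih =>
    obtain ⟨hc, hb⟩ := ih
    have hM : ∀ x, |walkValue ν q K k x| ≤ K := fun x ↦ abs_le.2 ⟨by linarith [hb x], (hb x).2⟩
    refine ⟨(continuous_putPayoff K).max ((continuous_integral_add ν hc hM).const_mul q),
      fun x ↦ ⟨le_max_of_le_left (putPayoff_nonneg K x), max_le (putPayoff_le hK x) ?_⟩⟩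
    have h1 : ∫ u, walkValue ν q K k (x + u) ∂ν ≤ K := by
      calc _ ≤ ∫ _, K ∂ν := integral_mono (integrable_comp_add ν hc hM x) (integrable_const _)
            fun u ↦ (hb _).2
        _ = K := by simp
    nlinarith

lemma continuous_walkValue (hq0 : 0 < q) (hq1 : q < 1) (hK : 0 < K) (k : ℕ) :
    Continuous (walkValue ν q K k) := (walkValue_aux hq0 hq1 hK k).1

lemma walkValue_nonneg (hq0 : 0 < q) (hq1 : q < 1) (hK : 0 < K) (k : ℕ) (x : ℝ) :
    0 ≤ walkValue ν q K k x := ((walkValue_aux hq0 hq1 hK k).2 x).1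

lemma walkValue_le (hq0 : 0 < q) (hq1 : q < 1) (hK : 0 < K) (k : ℕ) (x : ℝ) :
    walkValue ν q K k x ≤ K := ((walkValue_aux hq0 hq1 hK k).2 x).2

lemma abs_walkValue_le (hq0 : 0 < q) (hq1 : q < 1) (hK : 0 < K) (k : ℕ) (x : ℝ) :
    |walkValue ν q K k x| ≤ K :=
  abs_le.2 ⟨by linarith [walkValue_nonneg (ν := ν) hq0 hq1 hK k x], walkValue_le hq0 hq1 hK k x⟩

lemma integrable_walkValue (hq0 : 0 < q) (hq1 : q < 1) (hK : 0 < K) (k : ℕ) (x : ℝ) :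
    Integrable (fun u ↦ walkValue ν q K k (x + u)) ν :=
  integrable_comp_add ν (continuous_walkValue hq0 hq1 hK k) (abs_walkValue_le hq0 hq1 hK k) x

lemma walkValue_le_succ (hq0 : 0 < q) (hq1 : q < 1) (hK : 0 < K) (k : ℕ) (x : ℝ) :
    walkValue ν q K k x ≤ walkValue ν q K (k + 1) x := by
  induction k generalizing x with
  | zero => exact le_max_left _ _
  | succ k ih =>
    refine max_le_max le_rfl (mul_le_mul_of_nonneg_left ?_ hq0.le)
    exact integral_mono (integrable_walkValue hq0 hq1 hK k x)
      (integrable_walkValue hq0 hq1 hK (k + 1) x) fun u ↦ ih _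

lemma convexOn_putPayoff_log : ConvexOn ℝ (Ioi 0) fun s ↦ putPayoff K (Real.log s) := by
  have h : ConvexOn ℝ (Ioi (0 : ℝ)) fun s ↦ max (K - s) 0 := by
    refine ConvexOn.sup (f := fun s ↦ K - s) (g := fun _ ↦ 0) ?_ (convexOn_const 0 (convex_Ioi 0))
    exact (convexOn_const K (convex_Ioi 0)).sub (concaveOn_id (convex_Ioi 0))
  refine h.congr fun s hs ↦ ?_
  simp only [putPayoff, Real.exp_log (mem_Ioi.1 hs)]

/-- In the price variable `s = e^x` a step `u` multiplies `s` by `e^u`; dilations and averages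
preserve convexity. -/
lemma convexOn_integral_walkValue_log (hq0 : 0 < q) (hq1 : q < 1) (hK : 0 < K) {k : ℕ}
    (h : ConvexOn ℝ (Ioi 0) fun s ↦ walkValue ν q K k (Real.log s)) :
    ConvexOn ℝ (Ioi 0) fun s ↦ ∫ u, walkValue ν q K k (Real.log s + u) ∂ν := by
  refine ⟨convex_Ioi 0, fun s hs t ht a b ha hb hab ↦ ?_⟩
  have hs' : 0 < s := hs
  have ht' : 0 < t := ht
  have hst : 0 < a * s + b * t := by
    rcases ha.eq_or_lt with rfl | ha
    · have : b = 1 := by linarith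
      subst this; linarith
    · nlinarith [mul_pos ha hs', mul_nonneg hb ht'.le]
  simp only [smul_eq_mul]
  rw [← integral_const_mul, ← integral_const_mul, ← integral_add
    ((integrable_walkValue hq0 hq1 hK k _).const_mul a)
    ((integrable_walkValue hq0 hq1 hK k _).const_mul b)]
  refine integral_mono (integrable_walkValue hq0 hq1 hK k _)
    (((integrable_walkValue hq0 hq1 hK k _).const_mul a).add
      ((integrable_walkValue hq0 hq1 hK k _).const_mul b)) fun u ↦ ?_
  have key : ∀ w : ℝ, 0 < w → Real.log w + u = Real.log (w * Real.exp u) := fun w hw ↦ by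
    rw [Real.log_mul hw.ne' (Real.exp_pos u).ne', Real.log_exp]
  have := h.2 (show s * Real.exp u ∈ Ioi 0 from mul_pos hs' (Real.exp_pos u))
    (show t * Real.exp u ∈ Ioi 0 from mul_pos ht' (Real.exp_pos u)) ha hb hab
  simp only [smul_eq_mul] at this
  rw [key _ hst, key _ hs', key _ ht']
  convert! this using 3
  ring

lemma convexOn_walkValue_log (hq0 : 0 < q) (hq1 : q < 1) (hK : 0 < K) (k : ℕ) :
    ConvexOn ℝ (Ioi 0) fun s ↦ walkValue ν q K k (Real.log s) := by
  induction k with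
  | zero => exact convexOn_putPayoff_log
  | succ k ih =>
    exact convexOn_putPayoff_log.sup ((convexOn_integral_walkValue_log hq0 hq1 hK ih).smul hq0.le)

/-- The excess of continuing over exercising at `z`, with the payoff extended by `K - e ^ z`. -/
noncomputable def exerciseGap (ν : Measure ℝ) (q K : ℝ) (k : ℕ) (z : ℝ) : ℝ :=
  q * (∫ u, walkValue ν q K k (z + u) ∂ν) - (K - Real.exp z)

lemma continuous_exerciseGap (hq0 : 0 < q) (hq1 : q < 1) (hK : 0 < K) (k : ℕ) :
    Continuous (exerciseGap ν q K k) := by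
  have := continuous_integral_add ν (continuous_walkValue (ν := ν) hq0 hq1 hK k)
    (abs_walkValue_le hq0 hq1 hK k)
  unfold exerciseGap
  fun_prop

/-- Continuing is worth at most `q K`, so deep in the money immediate exercise wins. -/
lemma exerciseGap_neg (hq0 : 0 < q) (hq1 : q < 1) (hK : 0 < K) (k : ℕ) {z : ℝ}
    (hz : z < Real.log ((1 - q) * K)) : exerciseGap ν q K k z < 0 := by
  have h1 : Real.exp z < (1 - q) * K :=
    (Real.lt_log_iff_exp_lt (mul_pos (by linarith) hK)).1 hz
  have h2 : ∫ u, walkValue ν q K k (z + u) ∂ν ≤ K := by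
    calc _ ≤ ∫ _, K ∂ν := integral_mono (integrable_walkValue hq0 hq1 hK k z) (integrable_const _)
          fun u ↦ walkValue_le hq0 hq1 hK k _
      _ = K := by simp
  unfold exerciseGap
  nlinarith

lemma integral_walkValue_zero_pos (hq0 : 0 < q) (hq1 : q < 1) (hK : 0 < K)
    (htail : ∀ a, 0 < ν (Iio a)) (z : ℝ) : 0 < ∫ u, walkValue ν q K 0 (z + u) ∂ν := by
  rw [integral_pos_iff_support_of_nonneg (fun u ↦ walkValue_nonneg hq0 hq1 hK 0 _)
    (integrable_walkValue hq0 hq1 hK 0 z)]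
  refine (htail (Real.log K - z)).trans_le (measure_mono fun u hu ↦ ?_)
  have h : z + u < Real.log K := by linarith [mem_Iio.1 hu]
  have := (Real.lt_log_iff_exp_lt hK).1 h
  simp only [walkValue, Function.mem_support]
  rw [putPayoff_of_le hK h.le]
  linarith

lemma integral_walkValue_mono (hq0 : 0 < q) (hq1 : q < 1) (hK : 0 < K) {j k : ℕ} (hjk : j ≤ k)
    (z : ℝ) : ∫ u, walkValue ν q K j (z + u) ∂ν ≤ ∫ u, walkValue ν q K k (z + u) ∂ν :=
  integral_mono (integrable_walkValue hq0 hq1 hK j z) (integrable_walkValue hq0 hq1 hK k z)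
    fun u ↦ monotone_nat_of_le_succ
      (fun i ↦ walkValue_le_succ (ν := ν) hq0 hq1 hK i (z + u)) hjk

/-- The gap is negative far to the left and positive at `log K`, so it vanishes somewhere between;
convexity in `e^z` allows only one crossing. -/
lemma exists_boundary (hq0 : 0 < q) (hq1 : q < 1) (hK : 0 < K) (htail : ∀ a, 0 < ν (Iio a))
    (k : ℕ) : ∃ c, c < Real.log K ∧ exerciseGap ν q K k c = 0 ∧
      (∀ z, z < c → exerciseGap ν q K k z < 0) ∧ ∀ z, c < z → 0 < exerciseGap ν q K k z := by
  set g := exerciseGap ν q K k with hg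
  have hgc : Continuous g := continuous_exerciseGap hq0 hq1 hK k
  have hlogK : 0 < g (Real.log K) := by
    have := (integral_walkValue_zero_pos (ν := ν) hq0 hq1 hK htail (Real.log K)).trans_le
      (integral_walkValue_mono hq0 hq1 hK (Nat.zero_le k) _)
    simp only [hg, exerciseGap, Real.exp_log hK, sub_self, sub_zero]
    positivity
  have hqK : 0 < (1 - q) * K := mul_pos (by linarith) hK
  -- The shift by `1` makes the strict bound of `exerciseGap_neg` available at the endpoint `a`
  -- itself.
  set a := Real.log ((1 - q) * K) - 1 with ha
  have hneg : ∀ z, z ≤ a → g z < 0 := fun z hz ↦ exerciseGap_neg hq0 hq1 hK k (by linarith)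
  have haK : a ≤ Real.log K := by
    have := Real.log_le_log hqK (by nlinarith : (1 - q) * K ≤ K)
    linarith
  obtain ⟨c, hc, hc0⟩ := intermediate_value_Icc haK hgc.continuousOn
    ⟨(hneg a le_rfl).le, hlogK.le⟩
  have hcK : c < Real.log K := lt_of_le_of_ne hc.2 (by rintro rfl; linarith)
  have hconv : ConvexOn ℝ (Ioi 0) fun s ↦ g (Real.log s) := by
    have h1 := (convexOn_integral_walkValue_log (ν := ν) hq0 hq1 hK
      (convexOn_walkValue_log hq0 hq1 hK k)).smul hq0.le
    have h2 : ConcaveOn ℝ (Ioi (0 : ℝ)) fun s ↦ K - s :=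
      (concaveOn_const K (convex_Ioi 0)).sub (convexOn_id (convex_Ioi 0))
    refine (h1.sub h2).congr fun s hs ↦ ?_
    simp [hg, exerciseGap, Real.exp_log (mem_Ioi.1 hs)]
  -- a convex function, negative at the left end, cannot return to `0` or below
  have hlt : ∀ z₁ z₂ z₃, z₁ < z₂ → z₂ < z₃ → g z₁ < 0 → g z₃ ≤ 0 → g z₂ < 0 := by
    intro z₁ z₂ z₃ h12 h23 hz1 hz3
    have e12 := Real.exp_lt_exp.2 h12
    have e23 := Real.exp_lt_exp.2 h23
    have hd : 0 < Real.exp z₃ - Real.exp z₁ := by linarith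
    have p1 : 0 < (Real.exp z₃ - Real.exp z₂) / (Real.exp z₃ - Real.exp z₁) :=
      div_pos (by linarith) hd
    have p2 : 0 ≤ (Real.exp z₂ - Real.exp z₁) / (Real.exp z₃ - Real.exp z₁) :=
      div_nonneg (by linarith) hd.le
    have := hconv.2 (mem_Ioi.2 (Real.exp_pos z₁)) (mem_Ioi.2 (Real.exp_pos z₃)) p1.le p2
      (by field_simp; ring)
    have hcomb : (Real.exp z₃ - Real.exp z₂) / (Real.exp z₃ - Real.exp z₁) * Real.exp z₁ +
        (Real.exp z₂ - Real.exp z₁) / (Real.exp z₃ - Real.exp z₁) * Real.exp z₃ = Real.exp z₂ := by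
      field_simp; ring
    simp only [smul_eq_mul, Real.log_exp] at this
    rw [hcomb, Real.log_exp] at this
    nlinarith [mul_neg_of_pos_of_neg p1 hz1, mul_nonneg_of_nonpos_of_nonpos
      (neg_nonpos.2 p2) hz3]
  refine ⟨c, hcK, hc0, fun z hz ↦ ?_, fun z hz ↦ ?_⟩
  · by_cases hza : z ≤ a
    · exact hneg z hza
    · exact hlt a z c (not_le.1 hza) hz (hneg a le_rfl) hc0.le
  · by_contra! hcon
    have hac : a < c := lt_of_le_of_ne hc.1 (by rintro rfl; linarith [hneg _ le_rfl])
    linarith [hlt a c z hac hz (hneg a le_rfl) hcon]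

/-- Structure of the optimal exercise boundaries of the discrete-time put problem. -/
theorem exists_exercise_boundaries (hq0 : 0 < q) (hq1 : q < 1) (hK : 0 < K)
    (htail : ∀ a, 0 < ν (Iio a)) (hsupp : ∀ δ, 0 < δ → 0 < ν (Ioi (-δ))) :
    ∃ b : ℕ → ℝ, b 0 = Real.log K ∧
      (0 < ν (Ioi 0) → StrictAnti b) ∧
      (ν (Ioi 0) = 0 → b 1 < b 0 ∧ ∀ k, 1 ≤ k → b k = b 1) ∧
      ∀ k : ℕ,
        (0 < ν (Ioi 0) → IsUniqueZeroOn
          (fun z ↦ q * (∫ u, walkValue ν q K k (z + u) ∂ν) - putPayoff K z)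
          (Iio (b k)) (b (k + 1))) ∧
        (ν (Ioi 0) = 0 → IsUniqueZeroOn
          (fun z ↦ q * (∫ u, walkValue ν q K k (z + u) ∂ν) - putPayoff K z)
          (Iio (b 0)) (b (k + 1))) ∧
        (∀ x, x ≤ b (k + 1) → walkValue ν q K (k + 1) x = putPayoff K x) ∧
        (∀ x, b (k + 1) < x →
          walkValue ν q K (k + 1) x = q * ∫ u, walkValue ν q K k (x + u) ∂ν) ∧
        (∀ x, b (k + 1) < x → walkValue ν q K k x < walkValue ν q K (k + 1) x) := by
  choose c hcK hc0 hcneg hcpos using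
    fun k ↦ exists_boundary (ν := ν) (q := q) (K := K) hq0 hq1 hK htail k
  set b : ℕ → ℝ := fun k ↦ Nat.casesOn k (Real.log K) c with hb
  have hb0 : b 0 = Real.log K := rfl
  have hbs : ∀ k, b (k + 1) = c k := fun k ↦ rfl
  have hbK : ∀ k, b k ≤ Real.log K := fun k ↦ by
    cases k with
    | zero => exact le_rfl
    | succ k => exact (hcK k).le
  have hexer : ∀ k x, x ≤ b (k + 1) → walkValue ν q K (k + 1) x = putPayoff K x := by
    intro k x hx
    refine max_eq_left ?_
    rw [putPayoff_of_le hK (hx.trans (hcK k).le)]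
    have : exerciseGap ν q K k x ≤ 0 := by
      rcases hx.eq_or_lt with rfl | hx
      · exact (hc0 k).le
      · exact (hcneg k x hx).le
    unfold exerciseGap at this
    linarith
  have hcont : ∀ k x, b (k + 1) < x →
      putPayoff K x < q * ∫ u, walkValue ν q K k (x + u) ∂ν := by
    intro k x hx
    rcases le_or_gt x (Real.log K) with hxK | hxK
    · rw [putPayoff_of_le hK hxK]
      have := hcpos k x hx
      unfold exerciseGap at this
      linarith
    · rw [putPayoff_of_ge hK hxK.le]
      exact mul_pos hq0 ((integral_walkValue_zero_pos (ν := ν) hq0 hq1 hK htail x).trans_le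
        (integral_walkValue_mono hq0 hq1 hK (Nat.zero_le k) _))
  have hcont' : ∀ k x, b (k + 1) < x →
      walkValue ν q K (k + 1) x = q * ∫ u, walkValue ν q K k (x + u) ∂ν :=
    fun k x hx ↦ max_eq_right (hcont k x hx).le
  -- The order of consecutive boundaries is not yet known, hence the two cases. Left of the old
  -- boundary the old value is the payoff, which continuing now beats. Right of it both values are
  -- continuation values, and steps close to `0` or upward, which `hsupp` charges, land where the
  -- induction hypothesis is strict.
  have hstrict : ∀ k x, b (k + 1) < x → walkValue ν q K k x < walkValue ν q K (k + 1) x := by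
    intro k
    induction k with
    | zero => exact fun x hx ↦ (hcont 0 x hx).trans_le (le_max_right _ _)
    | succ k ih =>
      intro x hx
      rcases le_or_gt x (b (k + 1)) with hxb | hxb
      · rw [hexer k x hxb]
        exact (hcont (k + 1) x hx).trans_le (le_max_right _ _)
      · rw [hcont' k x hxb, hcont' (k + 1) x hx]
        refine mul_lt_mul_of_pos_left ?_ hq0
        refine integral_lt_integral_of_lt_on (s := Ioi (-(x - b (k + 1))))
          (integrable_walkValue hq0 hq1 hK k x) (integrable_walkValue hq0 hq1 hK (k + 1) x)
          (fun u ↦ walkValue_le_succ hq0 hq1 hK k _) (fun u hu ↦ ih _ ?_) (hsupp _ (by linarith))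
        linarith [mem_Ioi.1 hu]
  have hanti : 0 < ν (Ioi 0) → StrictAnti b := by
    intro hpos
    refine strictAnti_nat_of_succ_lt fun k ↦ ?_
    cases k with
    | zero => exact hcK 0
    | succ k =>
      -- From the old boundary every upward step lands where the value has strictly grown, so the
      -- new gap is already positive there.
      have hlt : ∫ u, walkValue ν q K k (c k + u) ∂ν <
          ∫ u, walkValue ν q K (k + 1) (c k + u) ∂ν :=
        integral_lt_integral_of_lt_on (s := Ioi 0)
          (integrable_walkValue hq0 hq1 hK k _) (integrable_walkValue hq0 hq1 hK (k + 1) _)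
          (fun u ↦ walkValue_le_succ hq0 hq1 hK k _)
          (fun u hu ↦ hstrict k _ (by rw [hbs]; linarith [mem_Ioi.1 hu])) hpos
      have h0 := hc0 k
      by_contra! hcon
      have h1 : exerciseGap ν q K (k + 1) (c k) ≤ 0 := by
        rcases (show c k ≤ c (k + 1) from hcon).eq_or_lt with h | h
        · rw [h]; exact (hc0 (k + 1)).le
        · exact (hcneg (k + 1) _ h).le
      unfold exerciseGap at h0 h1
      nlinarith
  have hconst : ν (Ioi 0) = 0 → ∀ k, c (k + 1) = c k := by
    intro hzero k
    -- Without upward steps the walk started at the old boundary stays where both values equal the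
    -- payoff, so the old zero is also a zero of the new gap.
    have heq : ∫ u, walkValue ν q K k (c k + u) ∂ν =
        ∫ u, walkValue ν q K (k + 1) (c k + u) ∂ν := by
      refine integral_congr_ae ?_
      have hae : ∀ᵐ u ∂ν, u ∉ Ioi 0 := measure_eq_zero_iff_ae_notMem.1 hzero
      filter_upwards [hae] with u hu
      have hu0 : u ≤ 0 := not_lt.1 hu
      have h := hexer k (c k + u) (by rw [hbs]; linarith)
      exact le_antisymm (walkValue_le_succ hq0 hq1 hK k _)
        (h.trans_le (putPayoff_le_walkValue ν q K k _))
    have h0 : exerciseGap ν q K (k + 1) (c k) = 0 := by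
      rw [← hc0 k]; simp only [exerciseGap, heq]
    rcases lt_trichotomy (c (k + 1)) (c k) with h | h | h
    · linarith [hcpos (k + 1) _ h]
    · exact h
    · linarith [hcneg (k + 1) _ h]
  have hgap : ∀ k z, z < Real.log K →
      q * (∫ u, walkValue ν q K k (z + u) ∂ν) - putPayoff K z = exerciseGap ν q K k z :=
    fun k z hz ↦ by rw [putPayoff_of_le hK hz.le]; rfl
  have huniq : ∀ k B, B ≤ Real.log K → c k < B → IsUniqueZeroOn
      (fun z ↦ q * (∫ u, walkValue ν q K k (z + u) ∂ν) - putPayoff K z) (Iio B) (c k) := by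
    intro k B hB hcB
    refine ⟨hcB, ?_, fun z hz hz0 ↦ ?_⟩
    · exact (hgap k _ (hcK k)).trans (hc0 k)
    · have h0 : exerciseGap ν q K k z = 0 := (hgap k z ((mem_Iio.1 hz).trans_le hB)).symm.trans hz0
      rcases lt_trichotomy z (c k) with h | h | h
      · linarith [hcneg k _ h]
      · exact h
      · linarith [hcpos k _ h]
  refine ⟨b, hb0, hanti, fun hzero ↦ ⟨hcK 0, fun k hk ↦ ?_⟩, fun k ↦
    ⟨fun hpos ↦ huniq k (b k) (hbK k) (hanti hpos (Nat.lt_succ_self k)),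
      fun _ ↦ huniq k (b 0) le_rfl (hcK k), hexer k, hcont' k, hstrict k⟩⟩
  induction k, hk using Nat.le_induction with
  | base => rfl
  | succ k hk ih =>
    obtain ⟨j, rfl⟩ : ∃ j, k = j + 1 := ⟨k - 1, by omega⟩
    exact (hconst hzero j).trans ih

end walkValue

/-! ### Verification of the optimal stopping value -/

section optimalStopping

variable {Ω : Type*} {ν : Measure ℝ} {q K : ℝ} {Y : ℕ → Ω → ℝ} {ι : Ω → ℕ} {x : ℝ}

/-- The payoff process of the rule `ι`, continued after time `j` by the value function. -/
noncomputable def interpolatedPayoff (ν : Measure ℝ) (q K : ℝ) (Y : ℕ → Ω → ℝ) (ι : Ω → ℕ) (k j : ℕ)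
    (ω : Ω) : ℝ :=
  if j ≤ ι ω then q ^ j * walkValue ν q K (k - j) (Y j ω)
  else q ^ ι ω * putPayoff K (Y (ι ω) ω)

/-- The loss caused by the decision of the rule `ι` at time `j`. -/
noncomputable def stoppingLoss (ν : Measure ℝ) (q K : ℝ) (Y : ℕ → Ω → ℝ) (ι : Ω → ℕ) (k j : ℕ) :
    Ω → ℝ :=
  {ω | ι ω = j}.indicator
      (fun ω ↦ q ^ j * (walkValue ν q K (k - j) (Y j ω) - putPayoff K (Y j ω))) +
    {ω | j < ι ω}.indicator (fun ω ↦ q ^ j * (walkValue ν q K (k - j) (Y j ω) -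
      q * ∫ u, walkValue ν q K (k - (j + 1)) (Y j ω + u) ∂ν))

/-- The value dominates both the payoff and the discounted continuation, so neither decision can
gain. -/
lemma stoppingLoss_nonneg (hq0 : 0 < q) {k j : ℕ} (hj : j < k) (ω : Ω) :
    0 ≤ stoppingLoss ν q K Y ι k j ω := by
  refine add_nonneg (indicator_nonneg (fun ω _ ↦ ?_) ω) (indicator_nonneg (fun ω _ ↦ ?_) ω)
  · exact mul_nonneg (pow_nonneg hq0.le _) (sub_nonneg.2 (putPayoff_le_walkValue ν q K _ _))
  · refine mul_nonneg (pow_nonneg hq0.le _) (sub_nonneg.2 ?_)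
    obtain ⟨i, hi⟩ : ∃ i, k - j = i + 1 := ⟨k - j - 1, by omega⟩
    rw [hi, show k - (j + 1) = i by omega]
    exact le_max_right _ _

/-- A Doob-type decomposition: one step subtracts a nonnegative loss and a term which has mean zero
by the Markov property. -/
lemma interpolatedPayoff_succ (k j : ℕ) (ω : Ω) :
    interpolatedPayoff ν q K Y ι k (j + 1) ω = interpolatedPayoff ν q K Y ι k j ω -
      stoppingLoss ν q K Y ι k j ω - q ^ (j + 1) * ({ω | j < ι ω}.indicator (fun ω ↦
        (∫ u, walkValue ν q K (k - (j + 1)) (Y j ω + u) ∂ν)) ω - {ω | j < ι ω}.indicator (fun ω ↦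
          walkValue ν q K (k - (j + 1)) (Y (j + 1) ω)) ω) := by
  unfold interpolatedPayoff stoppingLoss
  simp only [Pi.add_apply, indicator_apply, mem_ofPred_eq]
  rcases lt_trichotomy (ι ω) j with h | h | h
  · rw [if_neg (by omega), if_neg (by omega), if_neg (by omega), if_neg (by omega),
      if_neg (by omega), if_neg (by omega)]
    ring
  · rw [if_neg (by omega), if_pos (by omega), if_pos (by omega), if_neg (by omega),
      if_neg (by omega), if_neg (by omega), h]
    ring
  · rw [if_pos (by omega), if_pos (by omega), if_neg (by omega), if_pos (by omega),
      if_pos (by omega), if_pos (by omega)]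
    ring

lemma interpolatedPayoff_self (k : ℕ) (ω : Ω) : interpolatedPayoff ν q K Y ι k k ω =
    q ^ (min (ι ω) k) * putPayoff K (Y (min (ι ω) k) ω) := by
  unfold interpolatedPayoff
  split_ifs with h
  · rw [min_eq_right h, Nat.sub_self]; rfl
  · rw [min_eq_left (by omega)]

variable [MeasurableSpace Ω] {μ : Measure Ω} [IsProbabilityMeasure μ] [IsProbabilityMeasure ν]

lemma integrable_comp_of_bounded {φ : ℝ → ℝ} {M : ℝ} (hφ : Continuous φ) (hM : ∀ x, |φ x| ≤ M)
    {Z : Ω → ℝ} (hZ : AEMeasurable Z μ) : Integrable (fun ω ↦ φ (Z ω)) μ :=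
  Integrable.of_bound (hφ.measurable.comp_aemeasurable hZ).aestronglyMeasurable M
    (ae_of_all _ fun _ ↦ hM _)

lemma abs_integral_add_le {φ : ℝ → ℝ} {M : ℝ} (hM : ∀ x, |φ x| ≤ M) (x : ℝ) :
    |∫ u, φ (x + u) ∂ν| ≤ M := by
  have := norm_integral_le_of_norm_le_const (μ := ν) (f := fun u ↦ φ (x + u)) (C := M)
    (ae_of_all _ fun u ↦ hM _)
  simpa using this

/-- Verification for the stopping problem: the value function bounds the payoff of every rule, and
is attained by rules without loss. The hypothesis `hstep` is the Markov property along the rule. -/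
lemma integral_interpolatedPayoff (hq0 : 0 < q) (hq1 : q < 1) (hK : 0 < K)
    (hY : ∀ j, AEMeasurable (Y j) μ) (hY0 : ∀ᵐ ω ∂μ, Y 0 ω = x) (hι : AEMeasurable ι μ)
    (hstep : ∀ j (φ : ℝ → ℝ) (M : ℝ), Continuous φ → (∀ x, |φ x| ≤ M) →
      ∫ ω in {ω | j < ι ω}, φ (Y (j + 1) ω) ∂μ =
        ∫ ω in {ω | j < ι ω}, ∫ u, φ (Y j ω + u) ∂ν ∂μ) (k j : ℕ) (hj : j ≤ k) :
    Integrable (interpolatedPayoff ν q K Y ι k j) μ ∧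
    ∫ ω, interpolatedPayoff ν q K Y ι k j ω ∂μ ≤ walkValue ν q K k x ∧
    ((∀ i < k, stoppingLoss ν q K Y ι k i =ᵐ[μ] 0) →
      ∫ ω, interpolatedPayoff ν q K Y ι k j ω ∂μ = walkValue ν q K k x) := by
  induction j with
  | zero =>
    have h0 : interpolatedPayoff ν q K Y ι k 0 =ᵐ[μ] fun _ ↦ walkValue ν q K k x := by
      filter_upwards [hY0] with ω hω
      simp [interpolatedPayoff, hω]
    refine ⟨(integrable_const _).congr h0.symm, ?_, fun _ ↦ ?_⟩ <;>
    · rw [integral_congr_ae h0]; simp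
  | succ j ih =>
    obtain ⟨h1, h2, h3⟩ := ih (by omega)
    have hc := fun i ↦ continuous_walkValue (ν := ν) hq0 hq1 hK i
    have hb := fun i ↦ abs_walkValue_le (ν := ν) hq0 hq1 hK i
    have hWi : ∀ i l, Integrable (fun ω ↦ walkValue ν q K i (Y l ω)) μ := fun i l ↦
      integrable_comp_of_bounded (hc i) (hb i) (hY l)
    have hPi : ∀ i l, Integrable (fun ω ↦ ∫ u, walkValue ν q K i (Y l ω + u) ∂ν) μ := fun i l ↦
      integrable_comp_of_bounded (φ := fun y ↦ ∫ u, walkValue ν q K i (y + u) ∂ν)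
        (continuous_integral_add ν (hc i) (hb i)) (abs_integral_add_le (hb i)) (hY l)
    have hset : ∀ s : Set ℕ, NullMeasurableSet {ω | ι ω ∈ s} μ := fun s ↦
      hι.nullMeasurable (MeasurableSet.of_discrete (s := s))
    have hlt : NullMeasurableSet {ω | j < ι ω} μ := hset (Ioi j)
    have heq : NullMeasurableSet {ω | ι ω = j} μ := hset {j}
    have hloss : Integrable (stoppingLoss ν q K Y ι k j) μ :=
      -- `hWi 0 j` serves for the payoff, which is the value at level `0`.
      ((((hWi _ _).sub (hWi 0 j)).const_mul _).indicator₀ heq).add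
        ((((hWi _ _).sub ((hPi _ _).const_mul q)).const_mul _).indicator₀ hlt)
    set A := {ω | j < ι ω}.indicator fun ω ↦
      ∫ u, walkValue ν q K (k - (j + 1)) (Y j ω + u) ∂ν with hAdef
    set B := {ω | j < ι ω}.indicator fun ω ↦ walkValue ν q K (k - (j + 1)) (Y (j + 1) ω) with hBdef
    have hA : Integrable A μ := (hPi (k - (j + 1)) j).indicator₀ hlt
    have hB : Integrable B μ := (hWi (k - (j + 1)) (j + 1)).indicator₀ hlt
    have hIL : Integrable (fun ω ↦ interpolatedPayoff ν q K Y ι k j ω -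
      stoppingLoss ν q K Y ι k j ω) μ := h1.sub hloss
    have hAB : Integrable (fun ω ↦ q ^ (j + 1) * (A ω - B ω)) μ := (hA.sub hB).const_mul _
    have hfun : interpolatedPayoff ν q K Y ι k (j + 1) = fun ω ↦
        interpolatedPayoff ν q K Y ι k j ω - stoppingLoss ν q K Y ι k j ω -
          q ^ (j + 1) * (A ω - B ω) := funext fun ω ↦ interpolatedPayoff_succ k j ω
    -- The Markov property cancels the last term of the decomposition, so the expectation falls
    -- exactly by the expected loss.
    have hzero := hstep j _ K (hc (k - (j + 1))) (hb _)
    have hint : ∫ ω, interpolatedPayoff ν q K Y ι k (j + 1) ω ∂μ =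
        ∫ ω, interpolatedPayoff ν q K Y ι k j ω ∂μ - ∫ ω, stoppingLoss ν q K Y ι k j ω ∂μ := by
      rw [hfun, integral_sub hIL hAB, integral_sub h1 hloss,
        integral_const_mul, integral_sub hA hB, hAdef, hBdef, integral_indicator₀ hlt, integral_indicator₀ hlt,
        hzero]
      ring
    refine ⟨?_, ?_, fun h ↦ ?_⟩
    · rw [hfun]
      exact hIL.sub hAB
    · have := integral_nonneg (μ := μ) (f := stoppingLoss ν q K Y ι k j)
        (stoppingLoss_nonneg hq0 hj)
      linarith
    · rw [hint, integral_congr_ae (h j hj), h3 h]; simp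

end optimalStopping

/-! ### Dyadic approximation from the right -/

section dyadic

/-- The dyadic point of level `m` that lies strictly to the right of `t`, at distance at most
`2 ^ (-m)`. -/
noncomputable def dyadicRight (m : ℕ) (t : ℝ≥0) : ℝ≥0 := (⌊2 ^ m * t⌋₊ + 1 : ℕ) / 2 ^ m

lemma lt_dyadicRight (m : ℕ) (t : ℝ≥0) : t < dyadicRight m t := by
  unfold dyadicRight
  rw [lt_div_iff₀ (by positivity), mul_comm]
  exact_mod_cast Nat.lt_floor_add_one _

lemma dyadicRight_le (m : ℕ) (t : ℝ≥0) : dyadicRight m t ≤ t + (1 / 2) ^ m := by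
  unfold dyadicRight
  rw [div_le_iff₀ (by positivity), add_mul, ← mul_pow, one_div, inv_mul_cancel₀ two_ne_zero,
    one_pow, mul_comm t]
  push_cast
  gcongr
  exact Nat.floor_le (by positivity)

lemma tendsto_dyadicRight (t : ℝ≥0) : Tendsto (fun m ↦ dyadicRight m t) atTop (𝓝[>] t) := by
  refine tendsto_nhdsWithin_iff.2 ⟨?_, .of_forall fun m ↦ lt_dyadicRight m t⟩
  refine tendsto_of_tendsto_of_tendsto_of_le_of_le tendsto_const_nhds
    (h := fun m ↦ t + (1 / 2) ^ m) ?_ (fun m ↦ (lt_dyadicRight m t).le) (fun m ↦ dyadicRight_le m t)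
  have : Tendsto (fun m : ℕ ↦ (1 / 2 : ℝ≥0) ^ m) atTop (𝓝 0) :=
    NNReal.tendsto_pow_atTop_nhds_zero_of_lt_one (by rw [one_div]; exact inv_lt_one_of_one_lt₀ one_lt_two)
  simpa using tendsto_const_nhds.add this

/-- A process with right-continuous paths is jointly measurable. -/
lemma measurable_uncurry_of_rightContinuous {Ω : Type*} {m₀ : MeasurableSpace Ω}
    {Z : ℝ≥0 → Ω → ℝ} (hZ : ∀ t, Measurable (Z t))
    (hrc : ∀ ω t, ContinuousWithinAt (fun s ↦ Z s ω) (Ici t) t) :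
    Measurable fun p : Ω × ℝ≥0 ↦ Z p.2 p.1 := by
  refine measurable_of_tendsto_metrizable
    (f := fun m (p : Ω × ℝ≥0) ↦ Z (dyadicRight m p.2) p.1) (fun m ↦ ?_) ?_
  · have h1 : Measurable fun p : Ω × ℕ ↦ Z ((p.2 + 1 : ℕ) / 2 ^ m) p.1 :=
      measurable_from_prod_countable_left fun i ↦ hZ ((i + 1 : ℕ) / 2 ^ m)
    have h2 : Measurable fun p : Ω × ℝ≥0 ↦ (p.1, ⌊2 ^ m * p.2⌋₊) :=
      measurable_fst.prodMk (Nat.measurable_floor.comp (measurable_snd.const_mul _))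
    exact h1.comp h2
  · refine tendsto_pi_nhds.2 fun p ↦ ?_
    exact (hrc p.1 p.2).tendsto.comp ((tendsto_dyadicRight p.2).mono_right
      (nhdsWithin_mono _ Ioi_subset_Ici_self))

lemma measurable_eval_of_rightContinuous {Ω : Type*} {m₀ : MeasurableSpace Ω}
    {Z : ℝ≥0 → Ω → ℝ} (hZ : ∀ t, Measurable (Z t))
    (hrc : ∀ ω t, ContinuousWithinAt (fun s ↦ Z s ω) (Ici t) t) {ρ : Ω → ℝ≥0}
    (hρ : Measurable ρ) : Measurable fun ω ↦ Z (ρ ω) ω :=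
  (measurable_uncurry_of_rightContinuous hZ hrc).comp (measurable_id.prodMk hρ)

end dyadic

/-! ### Jump times of a counting path -/

section jumpTime

variable {Ω : Type*} {N : ℝ≥0 → Ω → ℕ}

/-- The jump time `T_k` as a finite time, meaningful where `T_k < ⊤`. -/
noncomputable def arrivalTime (N : ℝ≥0 → Ω → ℕ) (k : ℕ) (ω : Ω) : ℝ≥0 := (jumpTime N k ω).untopA

/-- A right-continuous integer-valued path is constant on some `[t, u)`, so level `k` cannot be
reached at times decreasing to `t` without being reached at `t`. -/
lemma jumpTime_le_iff (hmono : ∀ ω, Monotone fun t ↦ N t ω)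
    (hrc : ∀ ω t, ContinuousWithinAt (fun s ↦ N s ω) (Ici t) t) {k : ℕ} {ω : Ω} {t : ℝ≥0} :
    jumpTime N k ω ≤ t ↔ k ≤ N t ω := by
  refine ⟨fun h ↦ ?_, fun h ↦ iInf₂_le t h⟩
  by_contra! hlt
  have hev : {s | N s ω = N t ω} ∈ 𝓝[≥] t :=
    (hrc ω t).tendsto ((isOpen_discrete {N t ω}).mem_nhds rfl)
  obtain ⟨u, hu, hsub⟩ := (mem_nhdsGE_iff_exists_Ico_subset).1 hev
  have : (u : WithTop ℝ≥0) ≤ jumpTime N k ω := by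
    refine le_iInf₂ fun s hs ↦ WithTop.coe_le_coe.2 ?_
    by_contra! hsu
    rcases le_total s t with hst | hst
    · exact absurd (hs.trans (hmono ω hst)) (not_le.2 hlt)
    · have : N s ω = N t ω := hsub ⟨hst, hsu⟩
      omega
  exact absurd (WithTop.coe_le_coe.1 (this.trans h)) (not_le.2 hu)

lemma jumpTime_zero (ω : Ω) : jumpTime N 0 ω = ((0 : ℝ≥0) : WithTop ℝ≥0) :=
  le_antisymm (iInf₂_le (0 : ℝ≥0) (Nat.zero_le (N 0 ω))) (WithTop.coe_zero (α := ℝ≥0) ▸ bot_le)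

lemma jumpTime_mono (ω : Ω) : Monotone fun k ↦ jumpTime N k ω :=
  fun _ _ hjk ↦ le_iInf₂ fun s hs ↦ iInf₂_le s (hjk.trans hs)

lemma jumpTime_ne_top_iff {k : ℕ} {ω : Ω} : jumpTime N k ω ≠ ⊤ ↔ ∃ t, k ≤ N t ω := by
  refine ⟨fun h ↦ ?_, fun ⟨t, ht⟩ ↦ ne_top_of_le_ne_top WithTop.coe_ne_top (iInf₂_le t ht)⟩
  by_contra! hcon
  exact h (iInf₂_eq_top.2 fun s hs ↦ absurd hs (not_le.2 (hcon s)))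

lemma coe_arrivalTime {k : ℕ} {ω : Ω} (h : ∃ t, k ≤ N t ω) :
    (arrivalTime N k ω : WithTop ℝ≥0) = jumpTime N k ω := by
  rw [arrivalTime, WithTop.untopA_eq_untop (jumpTime_ne_top_iff.2 h), WithTop.coe_untop]

lemma arrivalTime_le_iff (hmono : ∀ ω, Monotone fun t ↦ N t ω)
    (hrc : ∀ ω t, ContinuousWithinAt (fun s ↦ N s ω) (Ici t) t) {k : ℕ} {ω : Ω}
    (h : ∃ t, k ≤ N t ω) {t : ℝ≥0} : arrivalTime N k ω ≤ t ↔ k ≤ N t ω := by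
  rw [← jumpTime_le_iff hmono hrc, ← coe_arrivalTime h, WithTop.coe_le_coe]

lemma arrivalTime_zero (ω : Ω) : arrivalTime N 0 ω = 0 := by
  rw [arrivalTime, jumpTime_zero, WithTop.untopA_eq_untop WithTop.coe_ne_top, WithTop.untop_coe]

lemma measurable_arrivalTime {m₀ : MeasurableSpace Ω} (hN : ∀ t, Measurable (N t))
    (hmono : ∀ ω, Monotone fun t ↦ N t ω)
    (hrc : ∀ ω t, ContinuousWithinAt (fun s ↦ N s ω) (Ici t) t) (k : ℕ) :
    Measurable (arrivalTime N k) := by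
  have hfin : MeasurableSet {ω | ∃ t, k ≤ N t ω} := by
    have : {ω | ∃ t, k ≤ N t ω} = ⋃ i : ℕ, {ω | k ≤ N i ω} := by
      ext ω
      simp only [mem_ofPred_eq, mem_iUnion]
      refine ⟨fun ⟨t, ht⟩ ↦ ?_, fun ⟨i, hi⟩ ↦ ⟨_, hi⟩⟩
      obtain ⟨i, hi⟩ := exists_nat_ge t
      exact ⟨i, ht.trans (hmono ω hi)⟩
    rw [this]
    exact MeasurableSet.iUnion fun i ↦ hN _ measurableSet_Ici
  refine measurable_of_Iic fun t ↦ ?_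
  -- Where level `k` is never reached, `arrivalTime` takes the default value `(⊤).untopA`, a
  -- constant, which the second piece accounts for.
  have : arrivalTime N k ⁻¹' Iic t = ({ω | ∃ t, k ≤ N t ω} ∩ {ω | k ≤ N t ω}) ∪
      ({ω | ∃ t, k ≤ N t ω}ᶜ ∩ {_ω | (⊤ : WithTop ℝ≥0).untopA ≤ t}) := by
    ext ω
    by_cases h : ∃ t, k ≤ N t ω
    · simp [h, arrivalTime_le_iff hmono hrc h]
    · have : jumpTime N k ω = ⊤ := by
        by_contra hcon; exact h (jumpTime_ne_top_iff.1 hcon)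
      simp only [mem_preimage, mem_Iic, arrivalTime, this, mem_union, mem_inter_iff,
        mem_ofPred_eq, h, false_and, mem_compl_iff, not_false_eq_true, true_and, false_or]
  rw [this]
  exact (hfin.inter (hN _ measurableSet_Ici)).union (hfin.compl.inter (MeasurableSet.const _))

end jumpTime

/-! ### Almost sure properties of Poisson paths -/

section poisson

/-- Each of the finitely many weights `e^{-r} r^i / i!` tends to `0`. This makes Poisson paths
unbounded. -/
lemma tendsto_poissonMeasure_Iio (k : ℕ) :
    Tendsto (fun r : ℝ≥0 ↦ poissonMeasure r (Iio k)) atTop (𝓝 0) := by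
  have h1 : ∀ r, poissonMeasure r (Iio k) ≤ ∑ i ∈ Finset.range k, poissonMeasure r {i} := by
    intro r
    have : Iio k = ⋃ i ∈ Finset.range k, {i} := by ext i; simp
    rw [this]
    exact measure_biUnion_finset_le _ _
  refine tendsto_of_tendsto_of_tendsto_of_le_of_le tendsto_const_nhds
    (h := fun r ↦ ∑ i ∈ Finset.range k, poissonMeasure r {i}) ?_ (fun _ ↦ zero_le) h1
  rw [← Finset.sum_const_zero (s := Finset.range k)]
  refine tendsto_finsetSum _ fun i _ ↦ ?_
  simp only [poissonMeasure_singleton]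
  rw [← ENNReal.ofReal_zero]
  refine ENNReal.tendsto_ofReal ?_
  have h2 : Tendsto (fun x : ℝ ↦ x ^ i * Real.exp (-x) / i.factorial) atTop (𝓝 0) := by
    simpa using (Real.tendsto_pow_mul_exp_neg_atTop_nhds_zero i).div_const _
  refine (h2.comp (NNReal.tendsto_coe_atTop.2 tendsto_id)).congr fun r ↦ ?_
  simp [mul_comm]

/-- The mass is `1 - e^{-r}(1 + r)`, and `e^{-r} ≥ 1 - r`. The quadratic order rules out double
jumps. -/
lemma poissonMeasure_Ici_two_le (r : ℝ≥0) :
    poissonMeasure r (Ici 2) ≤ ENNReal.ofReal ((r : ℝ) ^ 2) := by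
  have h1 : (Ici 2 : Set ℕ) = ({0, 1} : Set ℕ)ᶜ := by
    ext i; simp only [mem_Ici, mem_compl_iff, mem_insert_iff, mem_singleton_iff]; omega
  have h2 : (poissonMeasure r).real {0, 1} = Real.exp (-r) * (1 + r) := by
    rw [show ({0, 1} : Set ℕ) = {0} ∪ {1} from rfl, measureReal_union (by simp) (by simp),
      poissonMeasure_real_singleton, poissonMeasure_real_singleton]
    simp; ring
  rw [ENNReal.le_ofReal_iff_toReal_le (measure_ne_top _ _) (by positivity), ← measureReal_def, h1,
    probReal_compl_eq_one_sub (by simp), h2]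
  nlinarith [Real.add_one_le_exp (-(r : ℝ)), r.2]

variable {Ω : Type*} [MeasurableSpace Ω] {μ : Measure Ω} {N : ℝ≥0 → Ω → ℕ} {c : ℝ≥0}

lemma IsPoissonProcess.measure_increment (hN : IsPoissonProcess N c μ) (s t : ℝ≥0) (A : Set ℕ) :
    μ {ω | N (s + t) ω - N s ω ∈ A} = poissonMeasure (c * t) A := by
  rw [← (hN.incrementLaw s t).map_eq, Measure.map_apply_of_aemeasurable
    (hN.incrementLaw s t).aemeasurable MeasurableSet.of_discrete]
  rfl

/-- A Poisson process is almost surely unbounded. -/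
lemma IsPoissonProcess.ae_exists_le (hN : IsPoissonProcess N c μ) (hc : 0 < c) :
    ∀ᵐ ω ∂μ, ∀ k, ∃ t, k ≤ N t ω := by
  rw [ae_all_iff]
  intro k
  rw [ae_iff]
  have hle : ∀ m : ℕ, μ {ω | ¬∃ t, k ≤ N t ω} ≤ poissonMeasure (c * m) (Iio k) := fun m ↦ by
    rw [← hN.measure_increment 0 m]
    refine measure_mono fun ω hω ↦ ?_
    simp only [mem_ofPred_eq, not_exists, not_le, mem_Iio] at hω ⊢
    exact (Nat.sub_le _ _).trans_lt (hω _)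
  have hlim : Tendsto (fun m : ℕ ↦ poissonMeasure (c * m) (Iio k)) atTop (𝓝 0) :=
    (tendsto_poissonMeasure_Iio k).comp
      (tendsto_natCast_atTop_atTop.const_mul_atTop hc)
  exact le_antisymm (ge_of_tendsto' hlim hle) zero_le

/-- A Poisson process has almost surely no double jumps on a fine enough grid. -/
lemma IsPoissonProcess.ae_exists_grid (hN : IsPoissonProcess N c μ) :
    ∀ᵐ ω ∂μ, ∀ M : ℕ, ∃ m : ℕ, 0 < m ∧ ∀ i < M * m,
      N ((i + 1) / m) ω - N (i / m) ω ≤ 1 := by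
  rw [ae_all_iff]
  intro M
  rw [ae_iff]
  -- Of the `M m` cells of length `1/m` in `[0, M]`, each has a double jump with probability at most
  -- `(c/m)²`; the sum is `M c² / m`.
  have hle : ∀ m : ℕ, 0 < m → μ {ω | ¬∃ m : ℕ, 0 < m ∧ ∀ i < M * m,
      N ((i + 1) / m) ω - N (i / m) ω ≤ 1} ≤ ENNReal.ofReal (M * (c : ℝ) ^ 2 / m) := by
    intro m hm
    calc _ ≤ μ (⋃ i ∈ Finset.range (M * m), {ω | N (i / m + 1 / m) ω - N (i / m) ω ∈ Ici 2}) := by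
          refine measure_mono fun ω hω ↦ ?_
          simp only [mem_ofPred_eq, not_exists, not_and, not_forall, not_le] at hω
          obtain ⟨i, hi, h⟩ := hω m hm
          refine mem_iUnion₂.2 ⟨i, Finset.mem_range.2 hi, ?_⟩
          rw [mem_ofPred_eq, ← add_div]
          exact h
      _ ≤ ∑ i ∈ Finset.range (M * m), ENNReal.ofReal (((c * (1 / m) : ℝ≥0) : ℝ) ^ 2) := by
          refine (measure_biUnion_finset_le _ _).trans (Finset.sum_le_sum fun i _ ↦ ?_)
          rw [hN.measure_increment]
          exact poissonMeasure_Ici_two_le _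
      _ = _ := by
          rw [Finset.sum_const, Finset.card_range, nsmul_eq_mul, ← ENNReal.ofReal_natCast,
            ← ENNReal.ofReal_mul (by positivity)]
          congr 1
          push_cast
          field_simp
  have hlim : Tendsto (fun m : ℕ ↦ ENNReal.ofReal (M * (c : ℝ) ^ 2 / m)) atTop (𝓝 0) := by
    rw [← ENNReal.ofReal_zero]
    exact ENNReal.tendsto_ofReal (tendsto_const_div_atTop_nhds_zero_nat _)
  exact le_antisymm (ge_of_tendsto hlim ((eventually_gt_atTop 0).mono hle)) zero_le

/-- The jump times of a Poisson process are almost surely strictly increasing. -/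
lemma IsPoissonProcess.ae_strictMono_arrivalTime (hN : IsPoissonProcess N c μ) (hc : 0 < c) :
    ∀ᵐ ω ∂μ, StrictMono fun k ↦ arrivalTime N k ω := by
  filter_upwards [hN.ae_exists_le hc, hN.ae_exists_grid, hN.zero] with ω hfin hgrid hzero
  refine strictMono_nat_of_lt_succ fun j ↦ ?_
  have hiff := fun k t ↦ arrivalTime_le_iff hN.mono hN.rightContinuous (hfin k) (t := t)
  by_contra! hcon
  -- If `T_{j+1} ≤ T_j`, the cell `(i/m, (i+1)/m]` that contains `s` starts with fewer than `j`
  -- jumps and ends with at least `j + 1`, an increment of two or more.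
  set s := arrivalTime N (j + 1) ω with hs
  have hs0 : 0 < s := by
    by_contra! h
    have := (hiff (j + 1) 0).1 h
    omega
  obtain ⟨M, hM⟩ := exists_nat_ge s
  obtain ⟨m, hm, hgood⟩ := hgrid M
  have hm' : (0 : ℝ≥0) < m := by exact_mod_cast hm
  have hceil : 0 < ⌈s * m⌉₊ := Nat.ceil_pos.2 (mul_pos hs0 hm')
  obtain ⟨i, hi⟩ : ∃ i, ⌈s * m⌉₊ = i + 1 := ⟨⌈s * m⌉₊ - 1, by omega⟩
  have h1 : (i : ℝ≥0) / m < s := by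
    rw [div_lt_iff₀ hm']
    exact Nat.lt_ceil.1 (by omega)
  have h2 : s ≤ ((i : ℝ≥0) + 1) / m := by
    rw [le_div_iff₀ hm']
    have := Nat.le_ceil (s * m)
    rw [hi] at this
    exact_mod_cast this
  have h3 : i < M * m := by
    have : ⌈s * m⌉₊ ≤ M * m := Nat.ceil_le.2 (by push_cast; gcongr)
    omega
  have h4 : N (i / m) ω < j := by
    by_contra! h
    exact absurd (hcon.trans ((hiff j _).2 h)) (not_le.2 h1)
  have h5 := (hiff (j + 1) _).1 h2
  have := hgood i h3
  omega

end poisson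

/-! ### Independence of past and future, and evaluation at independent times -/

section indep

variable {Ω : Type*} [mΩ : MeasurableSpace Ω] {μ : Measure Ω}

lemma sup_eq_generateFrom_image2_inter {α : Type*} (a b : MeasurableSpace α) :
    a ⊔ b = MeasurableSpace.generateFrom
      (image2 (· ∩ ·) {s | MeasurableSet[a] s} {s | MeasurableSet[b] s}) := by
  refine le_antisymm (sup_le (fun s hs ↦ ?_) fun s hs ↦ ?_) (MeasurableSpace.generateFrom_le ?_)
  · exact MeasurableSpace.measurableSet_generateFrom
      ⟨s, hs, univ, MeasurableSet.univ, inter_univ s⟩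
  · exact MeasurableSpace.measurableSet_generateFrom
      ⟨univ, MeasurableSet.univ, s, hs, univ_inter s⟩
  · rintro _ ⟨s, hs, t, ht, rfl⟩
    exact ((le_sup_left : a ≤ a ⊔ b) s hs).inter ((le_sup_right : b ≤ a ⊔ b) t ht)

lemma isPiSystem_image2_inter {α : Type*} (a b : MeasurableSpace α) :
    IsPiSystem (image2 (· ∩ ·) {s | MeasurableSet[a] s} {s | MeasurableSet[b] s}) := by
  rintro _ ⟨s, hs, t, ht, rfl⟩ _ ⟨s', hs', t', ht', rfl⟩ -
  exact ⟨s ∩ s', hs.inter hs', t ∩ t', ht.inter ht', inter_inter_inter_comm _ _ _ _⟩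

/-- Pairs of σ-algebras that are independent within and across two groups can be regrouped. -/
lemma indep_sup_sup [IsProbabilityMeasure μ] {a a' b b' : MeasurableSpace Ω}
    (ha : a ≤ mΩ) (ha' : a' ≤ mΩ) (hb : b ≤ mΩ) (hb' : b' ≤ mΩ)
    (haa : Indep a a' μ) (hbb : Indep b b' μ) (hab : Indep (a ⊔ a') (b ⊔ b') μ) :
    Indep (a ⊔ b) (a' ⊔ b') μ := by
  refine IndepSets.indep (sup_le ha hb) (sup_le ha' hb') (isPiSystem_image2_inter a b)
    (isPiSystem_image2_inter a' b') (sup_eq_generateFrom_image2_inter a b)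
    (sup_eq_generateFrom_image2_inter a' b') ?_
  rw [IndepSets_iff]
  rintro _ _ ⟨s, hs, t, ht, rfl⟩ ⟨s', hs', t', ht', rfl⟩
  rw [Indep_iff] at haa hbb hab
  have la : a ≤ a ⊔ a' := le_sup_left
  have la' : a' ≤ a ⊔ a' := le_sup_right
  have lb : b ≤ b ⊔ b' := le_sup_left
  have lb' : b' ≤ b ⊔ b' := le_sup_right
  simp only
  rw [inter_inter_inter_comm, hab _ _ ((la s hs).inter (la' s' hs'))
    ((lb t ht).inter (lb' t' ht')), haa _ _ hs hs', hbb _ _ ht ht', hab _ _ (la s hs) (lb t ht),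
    hab _ _ (la' s' hs') (lb' t' ht')]
  ring

/-- Changing an event by a null set changes neither its probability nor those of its intersections.
-/
lemma Indep.eventuallyMeasurableSpace_left {a b : MeasurableSpace Ω} (h : Indep a b μ) :
    Indep (eventuallyMeasurableSpace a (ae μ)) b μ := by
  rw [Indep_iff] at h ⊢
  rintro s t ⟨s', hs', hss'⟩ ht
  have hst : (s ∩ t : Set Ω) =ᵐ[μ] (s' ∩ t : Set Ω) := hss'.inter (ae_eq_refl t)
  rw [measure_congr hst, measure_congr hss', h s' t hs' ht]

/-- The increasing enumeration is continued by its last element, giving an infinite time sequence to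
which independence of increments applies. -/
lemma exists_monotone_enumeration (S : Finset ℝ≥0) (hS : S.Nonempty) :
    ∃ t : ℕ → ℝ≥0, Monotone t ∧ ∀ s ∈ S, ∃ i, t i = s := by
  have hpos : 0 < S.card := Finset.card_pos.2 hS
  refine ⟨fun i ↦ S.orderEmbOfFin rfl ⟨min i (S.card - 1), by omega⟩, fun i j hij ↦ ?_,
    fun s hs ↦ ?_⟩
  · refine (S.orderEmbOfFin rfl).monotone ?_
    exact min_le_min hij le_rfl
  · have : s ∈ range (S.orderEmbOfFin rfl) := by rw [Finset.range_orderEmbOfFin]; exact hs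
    obtain ⟨i, hi⟩ := this
    refine ⟨i, ?_⟩
    have h2 : min i.1 (S.card - 1) = i := min_eq_left (by omega)
    simp only [h2]
    exact hi

/-- For a process with independent increments, the path before `q` and the increments after `q`
are independent. -/
lemma HasIndepIncrements.indepFun_past_future [IsProbabilityMeasure μ] {Z : ℝ≥0 → Ω → ℝ}
    (hZ : ∀ t, Measurable (Z t)) (h : HasIndepIncrements Z μ) (q : ℝ≥0) :
    IndepFun (fun ω (s : Iic q) ↦ Z s ω - Z 0 ω) (fun ω (s : ℝ≥0) ↦ Z (q + s) ω - Z q ω) μ := by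
  refine IndepFun.process_indepFun_process (X := fun (s : Iic q) ω ↦ Z s ω - Z 0 ω)
    (Y := fun (s : ℝ≥0) ω ↦ Z (q + s) ω - Z q ω)
    (fun s ↦ (hZ _).sub (hZ _)) (fun s ↦ (hZ _).sub (hZ _)) fun I J ↦ ?_
  -- With `0`, `q` and all times of interest on one sequence, past and future become sums over
  -- disjoint blocks of independent increments.
  obtain ⟨t, ht, hts⟩ := exists_monotone_enumeration
    ({0, q} ∪ I.image Subtype.val ∪ J.image (q + ·)) ⟨0, by simp⟩
  have ht0 : t 0 = 0 := by
    obtain ⟨i, hi⟩ := hts 0 (by simp)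
    exact le_antisymm (hi ▸ ht (Nat.zero_le i)) zero_le
  obtain ⟨k, hk⟩ := hts q (by simp)
  set inc : ℕ → Ω → ℝ := fun i ω ↦ Z (t (i + 1)) ω - Z (t i) ω with hinc
  have hincm : ∀ i, Measurable (inc i) := fun i ↦ (hZ _).sub (hZ _)
  set m : ℕ → MeasurableSpace Ω := fun i ↦ MeasurableSpace.comap (inc i) inferInstance with hm
  have hindep : iIndep m μ := (h.nat ht).iIndep
  have hsplit := indep_iSup_of_disjoint (fun i ↦ (hincm i).comap_le) hindep
    (S := Iio k) (T := Ici k) (Set.disjoint_left.2 fun i hi hi' ↦ (not_lt.2 (mem_Ici.1 hi')) (mem_Iio.1 hi))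
  have hmeas : ∀ (S : Set ℕ) (l : ℕ), l ∈ S → Measurable[⨆ i ∈ S, m i] (inc l) :=
    fun S l hl ↦ (comap_measurable (inc l)).mono (le_iSup₂_of_le l hl le_rfl) le_rfl
  refine indep_of_indep_of_le hsplit ?_ ?_
  · refine Measurable.comap_le ?_
    refine @measurable_pi_lambda _ _ _ (⨆ i ∈ Iio k, m i) _ _ fun s ↦ ?_
    obtain ⟨i, hi⟩ := hts s
      (Finset.mem_union_left _ (Finset.mem_union_right _ (Finset.mem_image_of_mem _ s.2)))
    have hsq : (s : ℝ≥0) ≤ q := s.1.2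
    -- The enumeration may repeat the value `q`, so `i` can exceed `k`; truncating the index keeps
    -- the time.
    have hmin : t (min i k) = s := by rw [ht.map_min, hi, hk]; exact min_eq_left hsq
    have heq : (fun ω ↦ Z s ω - Z 0 ω) = fun ω ↦ ∑ l ∈ Finset.range (min i k), inc l ω := by
      funext ω
      rw [Finset.sum_range_sub (fun l ↦ Z (t l) ω), hmin, ht0]
    rw [heq]
    exact Finset.measurable_fun_sum _ fun l hl ↦ hmeas _ l
      ((Finset.mem_range.1 hl).trans_le (min_le_right _ _))
  · refine Measurable.comap_le ?_
    refine @measurable_pi_lambda _ _ _ (⨆ i ∈ Ici k, m i) _ _ fun s ↦ ?_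
    obtain ⟨i, hi⟩ := hts (q + s) (Finset.mem_union_right _ (Finset.mem_image_of_mem _ s.2))
    have hmax : t (max i k) = q + s := by
      rw [ht.map_max, hi, hk]; exact max_eq_left le_self_add
    have heq : (fun ω ↦ Z (q + s) ω - Z q ω) = fun ω ↦ ∑ l ∈ Finset.Ico k (max i k), inc l ω := by
      funext ω
      rw [Finset.sum_Ico_sub (fun l ↦ Z (t l) ω) (le_max_right _ _), hmax, hk]
    rw [heq]
    exact Finset.measurable_fun_sum _ fun l hl ↦ hmeas _ l (Finset.mem_Ico.1 hl).1

/-- The law of a right-continuous process at an independent random time is a mixture of its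
marginals. -/
lemma measure_eval_independent_time {Ω' : Type*} [MeasurableSpace Ω'] [IsProbabilityMeasure μ]
    {G : Ω → Ω'} (hG : Measurable G) {Z : ℝ≥0 → Ω' → ℝ} (hZ : ∀ t, Measurable (Z t))
    (hrc : ∀ ω t, ContinuousWithinAt (fun s ↦ Z s ω) (Ici t) t) {ρ : Ω → ℝ≥0}
    (hρ : AEMeasurable ρ μ) (hind : IndepFun G ρ μ) {A : Set ℝ} (hA : MeasurableSet A) :
    μ {ω | Z (ρ ω) (G ω) ∈ A} = ∫⁻ t, μ {ω | Z t (G ω) ∈ A} ∂(μ.map ρ) := by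
  have hprob : IsProbabilityMeasure (μ.map G) := Measure.isProbabilityMeasure_map hG.aemeasurable
  have hprob' : IsProbabilityMeasure (μ.map ρ) := Measure.isProbabilityMeasure_map hρ
  have hS : MeasurableSet ((fun p : Ω' × ℝ≥0 ↦ Z p.2 p.1) ⁻¹' A) :=
    measurable_uncurry_of_rightContinuous hZ hrc hA
  have hmap := (indepFun_iff_map_prod_eq_prod_map_map hG.aemeasurable hρ).1 hind
  have h1 : μ {ω | Z (ρ ω) (G ω) ∈ A} =
      μ.map (fun ω ↦ (G ω, ρ ω)) ((fun p : Ω' × ℝ≥0 ↦ Z p.2 p.1) ⁻¹' A) := by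
    rw [Measure.map_apply_of_aemeasurable (hG.aemeasurable.prodMk hρ) hS]; rfl
  rw [h1, hmap, Measure.prod_apply_symm hS]
  refine lintegral_congr fun t ↦ ?_
  rw [Measure.map_apply hG (measurable_prodMk_right hS)]
  rfl

/-- The law of a right-continuous process at a random time independent of the path. -/
lemma measure_eval_of_indepFun_path [IsProbabilityMeasure μ] {Z : ℝ≥0 → Ω → ℝ}
    (hZ : ∀ t, Measurable (Z t))
    (hrc : ∀ ω t, ContinuousWithinAt (fun s ↦ Z s ω) (Ici t) t) {ρ : Ω → ℝ≥0}
    (hρ : AEMeasurable ρ μ) (hind : IndepFun ρ (fun ω t ↦ Z t ω) μ) {A : Set ℝ}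
    (hA : MeasurableSet A) :
    μ {ω | Z (ρ ω) ω ∈ A} = ∫⁻ t, μ {ω | Z t ω ∈ A} ∂(μ.map ρ) := by
  have hpath : Measurable fun ω t ↦ Z t ω := measurable_pi_lambda _ hZ
  -- The identity is viewed as a map into `Ω` with the σ-algebra of the path, the one assumed
  -- independent of `ρ`.
  let m' : MeasurableSpace Ω := MeasurableSpace.comap (fun ω t ↦ Z t ω) inferInstance
  refine @measure_eval_independent_time Ω mΩ μ Ω m' _ id (measurable_id'' hpath.comap_le)
    Z (fun t ↦ (measurable_pi_apply t).comp (comap_measurable (fun ω t ↦ Z t ω))) hrc ρ hρ ?_ A hA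
  have : Indep m' (MeasurableSpace.comap ρ inferInstance) μ := hind.symm
  rw [IndepFun_iff_Indep, MeasurableSpace.comap_id]
  exact this

end indep

/-! ### The Markov property at deterministic times -/

section markov

lemma comap_path_le {Ω T E : Type*} [MeasurableSpace E] {m : MeasurableSpace Ω} {Z : T → Ω → E}
    (h : ∀ t, Measurable[m] (Z t)) :
    MeasurableSpace.comap (fun ω t ↦ Z t ω) inferInstance ≤ m :=
  (@measurable_pi_lambda _ _ _ m _ (fun ω t ↦ Z t ω) h).comap_le

lemma measurable_coord_comap {Ω T E : Type*} [MeasurableSpace E] {m : MeasurableSpace Ω}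
    {Z : T → Ω → E} (h : MeasurableSpace.comap (fun ω t ↦ Z t ω) inferInstance ≤ m) (t : T) :
    Measurable[m] (Z t) :=
  ((measurable_pi_apply t).comp (comap_measurable fun ω t ↦ Z t ω)).mono h le_rfl

variable {Ω : Type*} [mΩ : MeasurableSpace Ω] {μ : Measure Ω}

/-- Monotone paths make the natural-number subtraction genuine, so increments commute with the cast
and the real-valued independence result applies to `N`. -/
lemma IsPoissonProcess.hasIndepIncrements_natCast {N : ℝ≥0 → Ω → ℕ} {c : ℝ≥0}
    (hN : IsPoissonProcess N c μ) : HasIndepIncrements (fun t ω ↦ (N t ω : ℝ)) μ := by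
  intro k t ht
  have h := (hN.indepIncrements k t ht).comp (γ := fun _ ↦ ℝ) (mγ := fun _ ↦ inferInstance)
    (fun _ (i : ℕ) ↦ (i : ℝ)) fun _ ↦ measurable_from_nat
  convert! h using 3 with i ω
  exact (Nat.cast_sub (hN.mono ω (ht (Fin.castSucc_lt_succ).le))).symm

lemma IsPoissonProcess.indepFun_past_future [IsProbabilityMeasure μ] {N : ℝ≥0 → Ω → ℕ} {c : ℝ≥0}
    (hN : IsPoissonProcess N c μ) (q : ℝ≥0) :
    IndepFun (fun ω (s : Iic q) ↦ N s ω - N 0 ω) (fun ω (s : ℝ≥0) ↦ N (q + s) ω - N q ω) μ := by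
  have h := (HasIndepIncrements.indepFun_past_future
    (fun t ↦ measurable_from_nat.comp (hN.measurable t)) hN.hasIndepIncrements_natCast q).comp
    (φ := fun (p : Iic q → ℝ) s ↦ ⌊p s⌋₊) (ψ := fun (p : ℝ≥0 → ℝ) s ↦ ⌊p s⌋₊)
    (by fun_prop) (by fun_prop)
  convert! h using 1
  · funext ω s
    simp only [Function.comp_apply]
    rw [← Nat.cast_sub (hN.mono ω zero_le), Nat.floor_natCast]
  · funext ω s
    simp only [Function.comp_apply]
    rw [← Nat.cast_sub (hN.mono ω le_self_add), Nat.floor_natCast]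

variable {X : ℝ≥0 → Ω → ℝ} {N : ℝ≥0 → Ω → ℕ} {c : ℝ≥0}

/-- The σ-algebra of the increments of `(X, N)` after time `q`. -/
abbrev futureSpace (X : ℝ≥0 → Ω → ℝ) (N : ℝ≥0 → Ω → ℕ) (q : ℝ≥0) : MeasurableSpace Ω :=
  MeasurableSpace.comap (fun ω (s : ℝ≥0) ↦ X (q + s) ω - X q ω) inferInstance ⊔
    MeasurableSpace.comap (fun ω (s : ℝ≥0) ↦ N (q + s) ω - N q ω) inferInstance

lemma futureSpace_le (hX : ∀ t, Measurable (X t)) (hN : ∀ t, Measurable (N t)) (q : ℝ≥0) :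
    futureSpace X N q ≤ mΩ :=
  sup_le (comap_path_le fun _ ↦ (hX _).sub (hX _)) (comap_path_le fun _ ↦ (hN _).sub (hN _))

/-- Past and future are independent for `X` and for `N` separately, and `X` is independent of `N`;
regrouping the four blocks gives the pair. Since `X_0 = N_0 = 0` almost surely, the increments from
time `0` generate the past up to null sets. -/
lemma indep_completedPairFiltration_futureSpace [IsProbabilityMeasure μ]
    (hX : IsLevyProcess X μ) (hN : IsPoissonProcess N c μ)
    (hXN : IndepFun (fun ω t ↦ X t ω) (fun ω t ↦ N t ω) μ) (q : ℝ≥0) :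
    Indep (completedPairFiltration μ X N hX.measurable hN.measurable q) (futureSpace X N q) μ := by
  set pX : Ω → Iic q → ℝ := fun ω s ↦ X s ω - X 0 ω with hpX
  set pN : Ω → Iic q → ℕ := fun ω s ↦ N s ω - N 0 ω with hpN
  set fX : Ω → ℝ≥0 → ℝ := fun ω s ↦ X (q + s) ω - X q ω with hfX
  set fN : Ω → ℝ≥0 → ℕ := fun ω s ↦ N (q + s) ω - N q ω with hfN
  have mpX : Measurable pX :=
    measurable_pi_lambda _ fun s ↦ (hX.measurable _).sub (hX.measurable _)
  have mpN : Measurable pN :=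
    measurable_pi_lambda _ fun s ↦ (hN.measurable _).sub (hN.measurable _)
  have mfX : Measurable fX :=
    measurable_pi_lambda _ fun s ↦ (hX.measurable _).sub (hX.measurable _)
  have mfN : Measurable fN :=
    measurable_pi_lambda _ fun s ↦ (hN.measurable _).sub (hN.measurable _)
  have hIX : Indep (MeasurableSpace.comap pX inferInstance)
      (MeasurableSpace.comap fX inferInstance) μ :=
    HasIndepIncrements.indepFun_past_future hX.measurable hX.indepIncrements q
  have hIN : Indep (MeasurableSpace.comap pN inferInstance)
      (MeasurableSpace.comap fN inferInstance) μ := hN.indepFun_past_future q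
  have hpath : Indep (MeasurableSpace.comap (fun ω t ↦ X t ω) inferInstance)
      (MeasurableSpace.comap (fun ω t ↦ N t ω) inferInstance) μ := hXN
  have hcX : ∀ t, Measurable[MeasurableSpace.comap (fun ω t ↦ X t ω) inferInstance] (X t) :=
    measurable_coord_comap le_rfl
  have hcN : ∀ t, Measurable[MeasurableSpace.comap (fun ω t ↦ N t ω) inferInstance] (N t) :=
    measurable_coord_comap le_rfl
  have hcross : Indep (MeasurableSpace.comap pX inferInstance ⊔
      MeasurableSpace.comap fX inferInstance) (MeasurableSpace.comap pN inferInstance ⊔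
      MeasurableSpace.comap fN inferInstance) μ := by
    refine indep_of_indep_of_le hpath (sup_le ?_ ?_) (sup_le ?_ ?_)
    · exact comap_path_le fun _ ↦ (hcX _).sub (hcX _)
    · exact comap_path_le fun _ ↦ (hcX _).sub (hcX _)
    · exact comap_path_le fun _ ↦ (hcN _).sub (hcN _)
    · exact comap_path_le fun _ ↦ (hcN _).sub (hcN _)
  have hmain := Indep.eventuallyMeasurableSpace_left
    (indep_sup_sup mpX.comap_le mfX.comap_le mpN.comap_le mfN.comap_le hIX hIN hcross)
  refine indep_of_indep_of_le_left hmain ?_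
  have hraw : (⨆ s ≤ q, MeasurableSpace.comap (fun ω ↦ (X s ω, N s ω)) inferInstance) ≤
      eventuallyMeasurableSpace (MeasurableSpace.comap pX inferInstance ⊔
        MeasurableSpace.comap pN inferInstance) (ae μ) := by
    refine iSup₂_le fun s hs ↦ Measurable.comap_le ?_
    have hm : Measurable[MeasurableSpace.comap pX inferInstance ⊔
        MeasurableSpace.comap pN inferInstance] fun ω ↦ (pX ω ⟨s, hs⟩, pN ω ⟨s, hs⟩) := by
      refine Measurable.prodMk ?_ ?_
      · exact measurable_coord_comap (Z := fun s ω ↦ pX ω s) le_sup_left ⟨s, hs⟩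
      · exact measurable_coord_comap (Z := fun s ω ↦ pN ω s) le_sup_right ⟨s, hs⟩
    refine hm.eventuallyMeasurable_of_eventuallyEq ?_
    filter_upwards [hX.zero, hN.zero] with ω h1 h2
    simp [hpX, hpN, h1, h2]
  rintro A ⟨B, hB, hAB⟩
  obtain ⟨B', hB', hBB'⟩ := hraw B hB
  exact ⟨B', hB', hAB.trans hBB'⟩

/-- The waiting time after `q` until the next jump of `N`. -/
noncomputable def waitingTime (N : ℝ≥0 → Ω → ℕ) (q : ℝ≥0) : Ω → ℝ≥0 :=
  arrivalTime (fun s ω ↦ N (q + s) ω - N q ω) 1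

/-- The increment of `X` from `q` to the next jump of `N`. -/
noncomputable def nextIncrement (X : ℝ≥0 → Ω → ℝ) (N : ℝ≥0 → Ω → ℕ) (q : ℝ≥0) (ω : Ω) : ℝ :=
  X (q + waitingTime N q ω) ω - X q ω

lemma continuousWithinAt_shift {E : Type*} [TopologicalSpace E] {Z : ℝ≥0 → E}
    (h : ∀ t, ContinuousWithinAt Z (Ici t) t) (q t : ℝ≥0) :
    ContinuousWithinAt (fun s ↦ Z (q + s)) (Ici t) t := by
  refine (h (q + t)).comp (t := Ici (q + t)) ?_ fun s hs ↦ add_le_add_right (mem_Ici.1 hs) q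
  exact (continuous_const.add continuous_id).continuousWithinAt

lemma IsPoissonProcess.shift_mono (hN : IsPoissonProcess N c μ) (q : ℝ≥0) (ω : Ω) :
    Monotone fun s ↦ N (q + s) ω - N q ω :=
  fun _ _ h ↦ Nat.sub_le_sub_right (hN.mono ω (add_le_add_right h q)) _

lemma IsPoissonProcess.shift_rightContinuous (hN : IsPoissonProcess N c μ) (q : ℝ≥0) (ω : Ω)
    (t : ℝ≥0) : ContinuousWithinAt (fun s ↦ N (q + s) ω - N q ω) (Ici t) t :=
  (continuous_of_discreteTopology (f := fun i : ℕ ↦ i - N q ω)).continuousAt.comp_continuousWithinAt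
    (continuousWithinAt_shift (hN.rightContinuous ω) q t)

lemma measurable_waitingTime_comap (hN : IsPoissonProcess N c μ) (q : ℝ≥0) :
    Measurable[MeasurableSpace.comap (fun ω (s : ℝ≥0) ↦ N (q + s) ω - N q ω) inferInstance]
      (waitingTime N q) :=
  measurable_arrivalTime (m₀ := MeasurableSpace.comap
      (fun ω (s : ℝ≥0) ↦ N (q + s) ω - N q ω) inferInstance)
    (measurable_coord_comap le_rfl)
    (hN.shift_mono q) (hN.shift_rightContinuous q) 1

lemma measurable_waitingTime (hN : IsPoissonProcess N c μ) (q : ℝ≥0) :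
    Measurable (waitingTime N q) :=
  (measurable_waitingTime_comap hN q).mono
    (comap_path_le fun _ ↦ (hN.measurable _).sub (hN.measurable _)) le_rfl

lemma measurable_nextIncrement (hX : IsLevyProcess X μ) (hN : IsPoissonProcess N c μ) (q : ℝ≥0) :
    Measurable[futureSpace X N q] (nextIncrement X N q) := by
  refine measurable_eval_of_rightContinuous (m₀ := futureSpace X N q)
    (Z := fun s ω ↦ X (q + s) ω - X q ω) (fun t ↦ ?_) (fun ω t ↦ ?_) (ρ := waitingTime N q) ?_
  · exact measurable_coord_comap (Z := fun (s : ℝ≥0) ω ↦ X (q + s) ω - X q ω) le_sup_left t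
  · exact (continuousWithinAt_shift (hX.rightContinuous ω) q t).sub continuousWithinAt_const
  · exact (measurable_waitingTime_comap hN q).mono le_sup_right le_rfl

/-- The waiting time of a Poisson process is exponentially distributed. -/
lemma map_waitingTime [IsProbabilityMeasure μ] (hN : IsPoissonProcess N c μ) (hc : 0 < c)
    (q : ℝ≥0) : μ.map (fun ω ↦ (waitingTime N q ω : ℝ)) = expMeasure c := by
  have hc' : (0 : ℝ) < c := hc
  have : IsProbabilityMeasure (expMeasure c) := isProbabilityMeasure_expMeasure hc'
  have hm : Measurable fun ω ↦ (waitingTime N q ω : ℝ) :=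
    measurable_coe_nnreal_real.comp (measurable_waitingTime hN q)
  have : IsProbabilityMeasure (μ.map fun ω ↦ (waitingTime N q ω : ℝ)) :=
    Measure.isProbabilityMeasure_map hm.aemeasurable
  refine Measure.eq_of_cdf _ _ ?_
  ext x
  rw [cdf_expMeasure_eq hc', cdf_eq_real, map_measureReal_apply hm measurableSet_Iic]
  split_ifs with hx
  · lift x to ℝ≥0 using hx
    have h1 : ((fun ω ↦ (waitingTime N q ω : ℝ)) ⁻¹' Iic (x : ℝ) : Set Ω) =ᵐ[μ]
        ({ω | N (q + x) ω - N q ω ∈ ({0} : Set ℕ)}ᶜ : Set Ω) := by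
      filter_upwards [hN.ae_exists_le hc] with ω hω
      have hex : ∃ s, 1 ≤ N (q + s) ω - N q ω := by
        obtain ⟨t, ht⟩ := hω (N q ω + 1)
        refine ⟨t, ?_⟩
        have := hN.mono ω (show t ≤ q + t from le_add_self)
        simp only at this
        omega
      have := arrivalTime_le_iff (hN.shift_mono q) (hN.shift_rightContinuous q) hex (t := x)
      apply propext
      change (waitingTime N q ω : ℝ) ≤ x ↔ ¬ (N (q + x) ω - N q ω = 0)
      rw [NNReal.coe_le_coe]
      exact this.trans (by omega)
    have h2 : MeasurableSet {ω | N (q + x) ω - N q ω ∈ ({0} : Set ℕ)} :=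
      ((hN.measurable _).sub (hN.measurable _)) (MeasurableSet.singleton 0)
    rw [measureReal_congr h1, probReal_compl_eq_one_sub h2, measureReal_def,
      hN.measure_increment, ← measureReal_def, poissonMeasure_real_singleton]
    simp
  · have : (fun ω ↦ (waitingTime N q ω : ℝ)) ⁻¹' Iic x = ∅ := by
      ext ω
      simp only [mem_preimage, mem_Iic, mem_empty_iff_false, iff_false, not_le]
      exact (not_le.1 hx).trans_le (waitingTime N q ω).2
    rw [this]; simp

lemma aemeasurable_of_hasLaw_coe {ξ : Ω → ℝ≥0} {ρ : Measure ℝ}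
    (hξ : HasLaw (fun ω ↦ (ξ ω : ℝ)) ρ μ) : AEMeasurable ξ μ := by
  have := measurable_real_toNNReal.comp_aemeasurable hξ.aemeasurable
  simpa [Function.comp_def] using this

lemma map_eq_map_toNNReal {ξ : Ω → ℝ≥0} (hξ : AEMeasurable ξ μ) :
    μ.map ξ = (μ.map fun ω ↦ (ξ ω : ℝ)).map Real.toNNReal := by
  rw [AEMeasurable.map_map_of_aemeasurable (f := fun ω ↦ (ξ ω : ℝ))
    measurable_real_toNNReal.aemeasurable (measurable_coe_nnreal_real.comp_aemeasurable hξ)]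
  simp [Function.comp_def]

/-- Both laws mix the marginals of `X` over the same exponential law: the waiting time is
distributed as `ξ` and is independent of the increments of `X`, which are stationary. -/
lemma map_nextIncrement [IsProbabilityMeasure μ] (hX : IsLevyProcess X μ)
    (hN : IsPoissonProcess N c μ) (hc : 0 < c)
    (hXN : IndepFun (fun ω t ↦ X t ω) (fun ω t ↦ N t ω) μ) {ξ : Ω → ℝ≥0}
    (hξ : HasLaw (fun ω ↦ (ξ ω : ℝ)) (expMeasure c) μ)
    (hξX : IndepFun ξ (fun ω t ↦ X t ω) μ) (hmeas : AEMeasurable (fun ω ↦ X (ξ ω) ω) μ) (q : ℝ≥0) :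
    μ.map (nextIncrement X N q) = μ.map fun ω ↦ X (ξ ω) ω := by
  have hξm := aemeasurable_of_hasLaw_coe hξ
  have hwm := measurable_waitingTime hN q
  have hlaw : μ.map (waitingTime N q) = μ.map ξ := by
    rw [map_eq_map_toNNReal hξm, map_eq_map_toNNReal hwm.aemeasurable, map_waitingTime hN hc,
      hξ.map_eq]
  have hind : IndepFun (waitingTime N q) (fun ω (s : ℝ≥0) ↦ X (q + s) ω - X q ω) μ := by
    have h1 : IndepFun (fun ω (s : ℝ≥0) ↦ N (q + s) ω - N q ω)
        (fun ω (s : ℝ≥0) ↦ X (q + s) ω - X q ω) μ :=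
      hXN.symm.comp (φ := fun (p : ℝ≥0 → ℕ) (s : ℝ≥0) ↦ p (q + s) - p q)
        (ψ := fun (p : ℝ≥0 → ℝ) (s : ℝ≥0) ↦ p (q + s) - p q) (by fun_prop) (by fun_prop)
    exact indep_of_indep_of_le_left h1 (measurable_waitingTime_comap hN q).comap_le
  ext A hA
  rw [Measure.map_apply ((measurable_nextIncrement hX hN q).mono
    (futureSpace_le hX.measurable hN.measurable q) le_rfl) hA,
    Measure.map_apply_of_aemeasurable hmeas hA]
  have e1 := measure_eval_of_indepFun_path (Z := fun s ω ↦ X (q + s) ω - X q ω)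
    (fun t ↦ (hX.measurable _).sub (hX.measurable _))
    (fun ω t ↦ (continuousWithinAt_shift (hX.rightContinuous ω) q t).sub continuousWithinAt_const)
    hwm.aemeasurable hind hA
  have e2 := measure_eval_of_indepFun_path hX.measurable hX.rightContinuous hξm hξX hA
  refine e1.trans (Eq.trans ?_ e2.symm)
  rw [hlaw]
  refine lintegral_congr fun t ↦ ?_
  refine ((hX.stationaryIncrements q t).measure_mem_eq hA).trans (measure_congr ?_)
  filter_upwards [hX.zero] with ω hω
  apply propext
  change X t ω - X 0 ω ∈ A ↔ X t ω ∈ A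
  rw [hω, sub_zero]

/-- The Markov property of `(X, N)` at the deterministic time `q`. -/
lemma setIntegral_nextIncrement [IsProbabilityMeasure μ] (hX : IsLevyProcess X μ)
    (hN : IsPoissonProcess N c μ) (hc : 0 < c)
    (hXN : IndepFun (fun ω t ↦ X t ω) (fun ω t ↦ N t ω) μ) {ξ : Ω → ℝ≥0}
    (hξ : HasLaw (fun ω ↦ (ξ ω : ℝ)) (expMeasure c) μ)
    (hξX : IndepFun ξ (fun ω t ↦ X t ω) μ) (hmeas : AEMeasurable (fun ω ↦ X (ξ ω) ω) μ) (q : ℝ≥0)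
    {E : Set Ω} (hE : MeasurableSet[completedPairFiltration μ X N hX.measurable hN.measurable q] E)
    {φ : ℝ → ℝ} {B : ℝ} (hφ : Continuous φ) (hB : ∀ x, |φ x| ≤ B) (x : ℝ) :
    ∫ ω in E, φ (x + X (q + waitingTime N q ω) ω) ∂μ =
      ∫ ω in E, ∫ u, φ (x + X q ω + u) ∂(μ.map fun ω ↦ X (ξ ω) ω) ∂μ := by
  set ν := μ.map fun ω ↦ X (ξ ω) ω with hν
  have hνp : IsProbabilityMeasure ν := Measure.isProbabilityMeasure_map hmeas
  -- `E` may fail to be measurable in `Ω`; it is replaced by an almost surely equal event of the raw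
  -- σ-algebra.
  obtain ⟨E', hE', hEE'⟩ := hE
  have hE'm : MeasurableSet E' :=
    (iSup₂_le fun s _ ↦ ((hX.measurable s).prodMk (hN.measurable s)).comap_le :
      (⨆ s ≤ q, MeasurableSpace.comap (fun ω ↦ (X s ω, N s ω)) inferInstance) ≤ mΩ) E' hE'
  rw [setIntegral_congr_set hEE', setIntegral_congr_set hEE']
  have hΔm : Measurable (nextIncrement X N q) := (measurable_nextIncrement hX hN q).mono
    (futureSpace_le hX.measurable hN.measurable q) le_rfl
  -- `G` packs everything known at time `q` that the integrand uses, so Fubini applies to its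
  -- product law with the next increment.
  set G : Ω → ℝ × ℝ := fun ω ↦ (E'.indicator (fun _ ↦ 1) ω, X q ω) with hG
  have hGm : Measurable G := (measurable_const.indicator hE'm).prodMk (hX.measurable q)
  have hGraw : Measurable[⨆ s ≤ q, MeasurableSpace.comap (fun ω ↦ (X s ω, N s ω)) inferInstance]
      G := by
    have hXq : Measurable[⨆ s ≤ q, MeasurableSpace.comap (fun ω ↦ (X s ω, N s ω)) inferInstance]
        (X q) := (measurable_fst.comp (comap_measurable fun ω ↦ (X q ω, N q ω))).mono
      (le_iSup₂_of_le q le_rfl le_rfl) le_rfl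
    exact Measurable.prodMk (Measurable.indicator measurable_const hE') hXq
  have hind : IndepFun G (nextIncrement X N q) μ :=
    indep_of_indep_of_le (indep_completedPairFiltration_futureSpace hX hN hXN q)
      (hGraw.mono le_eventuallyMeasurableSpace le_rfl).comap_le
      (measurable_nextIncrement hX hN q).comap_le
  have hmap := (indepFun_iff_map_prod_eq_prod_map_map hGm.aemeasurable hΔm.aemeasurable).1 hind
  rw [map_nextIncrement hX hN hc hXN hξ hξX hmeas q, ← hν] at hmap
  have hGp : IsProbabilityMeasure (μ.map G) := Measure.isProbabilityMeasure_map hGm.aemeasurable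
  set F : (ℝ × ℝ) × ℝ → ℝ := fun p ↦ p.1.1 * φ (x + p.1.2 + p.2) with hF
  have hFc : Continuous F := by simp only [hF]; fun_prop
  have hI : ∫ ω, F (G ω, nextIncrement X N q ω) ∂μ = ∫ ω, ∫ u, F (G ω, u) ∂ν ∂μ := by
    have h1 : ∫ p, F p ∂(μ.map fun ω ↦ (G ω, nextIncrement X N q ω)) =
        ∫ ω, F (G ω, nextIncrement X N q ω) ∂μ :=
      integral_map (hGm.prodMk hΔm).aemeasurable hFc.aestronglyMeasurable
    have hint : Integrable F ((μ.map G).prod ν) := by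
      rw [← hmap, integrable_map_measure hFc.aestronglyMeasurable (hGm.prodMk hΔm).aemeasurable]
      refine Integrable.of_bound (hFc.measurable.comp (hGm.prodMk hΔm)).aestronglyMeasurable B
        (ae_of_all _ fun ω ↦ ?_)
      simp only [hF, hG, Function.comp_apply, norm_mul, Real.norm_eq_abs]
      have := hB (x + X q ω + nextIncrement X N q ω)
      by_cases hω : ω ∈ E'
      · simpa [hω] using this
      · simpa [hω] using (abs_nonneg _).trans this
    rw [← h1, hmap, integral_prod _ hint, integral_map hGm.aemeasurable]
    exact hint.integral_prod_left.aestronglyMeasurable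
  rw [← integral_indicator hE'm, ← integral_indicator hE'm]
  have e1 : ∀ ω, F (G ω, nextIncrement X N q ω) =
      E'.indicator (fun ω ↦ φ (x + X (q + waitingTime N q ω) ω)) ω := fun ω ↦ by
    simp only [hF, hG, nextIncrement]
    by_cases hω : ω ∈ E'
    · simp only [hω, indicator_of_mem, one_mul]; congr 1; ring
    · simp [hω]
  have e2 : ∀ ω, ∫ u, F (G ω, u) ∂ν =
      E'.indicator (fun ω ↦ ∫ u, φ (x + X q ω + u) ∂ν) ω := fun ω ↦ by
    simp only [hF, hG]
    by_cases hω : ω ∈ E' <;> simp [hω]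
  simp only [e1, e2] at hI
  exact hI

end markov

/-! ### The strong Markov property at jump times -/

section strongMarkov

variable {Ω : Type*} [mΩ : MeasurableSpace Ω] {μ : Measure Ω}
  {X : ℝ≥0 → Ω → ℝ} {N : ℝ≥0 → Ω → ℕ} {c : ℝ≥0}

lemma exists_dyadic_between {s t : ℝ≥0} (h : s < t) :
    ∃ p : ℕ × ℕ, s < (p.2 : ℝ≥0) / 2 ^ p.1 ∧ (p.2 : ℝ≥0) / 2 ^ p.1 < t := by
  have hev : ∀ᶠ m in atTop, dyadicRight m s < t :=
    ((tendsto_dyadicRight s).mono_right nhdsWithin_le_nhds).eventually (gt_mem_nhds h)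
  obtain ⟨m, hm⟩ := hev.exists
  exact ⟨(m, ⌊2 ^ m * s⌋₊ + 1), lt_dyadicRight m s, hm⟩

lemma measurable_completedPairFiltration_snd (hX : ∀ t, Measurable (X t))
    (hN : ∀ t, Measurable (N t)) {t q : ℝ≥0} (htq : t ≤ q) :
    Measurable[completedPairFiltration μ X N hX hN q] (N t) := by
  have h : Measurable[⨆ s ≤ q, MeasurableSpace.comap (fun ω ↦ (X s ω, N s ω)) inferInstance]
      (N t) := (measurable_snd.comp (comap_measurable fun ω ↦ (X t ω, N t ω))).mono
    (le_iSup₂_of_le t htq le_rfl) le_rfl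
  exact h.mono le_eventuallyMeasurableSpace le_rfl

lemma IsPoissonProcess.measurableSet_jumpTime_le (hX : ∀ t, Measurable (X t))
    (hN : IsPoissonProcess N c μ) (j : ℕ) {t q : ℝ≥0} (htq : t ≤ q) :
    MeasurableSet[completedPairFiltration μ X N hX hN.measurable q]
      {ω | jumpTime N j ω ≤ t} := by
  have : {ω | jumpTime N j ω ≤ t} = N t ⁻¹' Ici j := by
    ext ω; exact jumpTime_le_iff hN.mono hN.rightContinuous
  rw [this]
  exact measurable_completedPairFiltration_snd hX hN.measurable htq measurableSet_Ici

lemma IsPoissonProcess.measurableSet_jumpTime_lt (hX : ∀ t, Measurable (X t))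
    (hN : IsPoissonProcess N c μ) (j : ℕ) {t q : ℝ≥0} (htq : t ≤ q) :
    MeasurableSet[completedPairFiltration μ X N hX hN.measurable q]
      {ω | jumpTime N j ω < t} := by
  have : {ω | jumpTime N j ω < t} = ⋃ p : {p : ℕ × ℕ // (p.2 : ℝ≥0) / 2 ^ p.1 < t},
      {ω | jumpTime N j ω ≤ (((p.1.2 : ℝ≥0) / 2 ^ p.1.1 : ℝ≥0) : WithTop ℝ≥0)} := by
    ext ω
    simp only [mem_ofPred_eq, mem_iUnion]
    refine ⟨fun h ↦ ?_, fun ⟨p, hp⟩ ↦ hp.trans_lt (WithTop.coe_lt_coe.2 p.2)⟩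
    obtain ⟨s, hs⟩ := WithTop.ne_top_iff_exists.1 h.ne_top
    rw [← hs] at h ⊢
    obtain ⟨p, hp1, hp2⟩ := exists_dyadic_between (WithTop.coe_lt_coe.1 h)
    exact ⟨⟨p, hp2⟩, WithTop.coe_le_coe.2 hp1.le⟩
  rw [this]
  exact MeasurableSet.iUnion fun p ↦ hN.measurableSet_jumpTime_le hX j (p.2.le.trans htq)

/-- The right limit of the filtration at `t` lies in the completed σ-algebra at every later `q`.
This strict delay is the price for removing right continuity, and dyadic times from the right pay
it. -/
lemma measurableSet_le_of_isStoppingTime {hX : ∀ t, Measurable (X t)}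
    {hN : ∀ t, Measurable (N t)} {τ : Ω → WithTop ℝ≥0}
    (hτ : IsStoppingTime (enlargedPairFiltration μ X N hX hN) τ) {t q : ℝ≥0} (htq : t < q) :
    MeasurableSet[completedPairFiltration μ X N hX hN q] {ω | τ ω ≤ t} := by
  have h : (enlargedPairFiltration μ X N hX hN) t ≤ completedPairFiltration μ X N hX hN q := by
    rw [enlargedPairFiltration, Filtration.rightCont_eq]
    exact iInf₂_le q htq
  exact h _ (hτ t)

/-- A dyadic time fits strictly between `T_j` and `min τ q`, and it witnesses the event before `q`.
-/
lemma measurableSet_jumpTime_lt_stoppingTime (hX : ∀ t, Measurable (X t))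
    (hN : IsPoissonProcess N c μ) {τ : Ω → WithTop ℝ≥0}
    (hτ : IsStoppingTime (enlargedPairFiltration μ X N hX hN.measurable) τ) (j : ℕ) (q : ℝ≥0) :
    MeasurableSet[completedPairFiltration μ X N hX hN.measurable q]
      {ω | jumpTime N j ω < τ ω ∧ jumpTime N j ω < q} := by
  have : {ω | jumpTime N j ω < τ ω ∧ jumpTime N j ω < q} =
      ⋃ p : {p : ℕ × ℕ // (p.2 : ℝ≥0) / 2 ^ p.1 < q},
      ({ω | jumpTime N j ω ≤ (((p.1.2 : ℝ≥0) / 2 ^ p.1.1 : ℝ≥0) : WithTop ℝ≥0)} ∩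
        {ω | τ ω ≤ (((p.1.2 : ℝ≥0) / 2 ^ p.1.1 : ℝ≥0) : WithTop ℝ≥0)}ᶜ) := by
    ext ω
    simp only [mem_ofPred_eq, mem_iUnion, mem_inter_iff, mem_compl_iff, not_le]
    refine ⟨fun ⟨h1, h2⟩ ↦ ?_,
      fun ⟨p, hp, hp'⟩ ↦ ⟨hp.trans_lt hp', hp.trans_lt (WithTop.coe_lt_coe.2 p.2)⟩⟩
    obtain ⟨v, hv⟩ := WithTop.ne_top_iff_exists.1
      (ne_top_of_le_ne_top WithTop.coe_ne_top (min_le_right (τ ω) (q : WithTop ℝ≥0)))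
    have hlt : jumpTime N j ω < min (τ ω) q := lt_min h1 h2
    obtain ⟨s, hs⟩ := WithTop.ne_top_iff_exists.1 h2.ne_top
    rw [← hs, ← hv] at hlt
    rw [← hs]
    obtain ⟨p, hp1, hp2⟩ := exists_dyadic_between (WithTop.coe_lt_coe.1 hlt)
    have hp3 := WithTop.coe_lt_coe.2 hp2
    rw [hv] at hp3
    exact ⟨⟨p, WithTop.coe_lt_coe.1 (hp3.trans_le (min_le_right _ _))⟩,
      WithTop.coe_le_coe.2 hp1.le, hp3.trans_le (min_le_left _ _)⟩
  rw [this]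
  exact MeasurableSet.iUnion fun p ↦ (hN.measurableSet_jumpTime_le hX j p.2.le).inter
    (measurableSet_le_of_isStoppingTime hτ p.2).compl

/-- The event that `τ` has not stopped at `T_j` and `T_j` lies in a given dyadic interval. -/
lemma measurableSet_jumpTime_dyadic (hX : ∀ t, Measurable (X t))
    (hN : IsPoissonProcess N c μ) {τ : Ω → WithTop ℝ≥0}
    (hτ : IsStoppingTime (enlargedPairFiltration μ X N hX hN.measurable) τ) (j m i : ℕ) :
    MeasurableSet[completedPairFiltration μ X N hX hN.measurable ((i + 1 : ℕ) / 2 ^ m)]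
      ({ω | jumpTime N j ω < τ ω} ∩ {ω | ⌊2 ^ m * arrivalTime N j ω⌋₊ = i}) := by
  have hpow : (0 : ℝ≥0) < 2 ^ m := by positivity
  have : {ω | jumpTime N j ω < τ ω} ∩ {ω | ⌊2 ^ m * arrivalTime N j ω⌋₊ = i} =
      {ω | jumpTime N j ω < τ ω ∧ jumpTime N j ω < (((i + 1 : ℕ) / 2 ^ m : ℝ≥0) : WithTop ℝ≥0)} \
        {ω | jumpTime N j ω < (((i : ℝ≥0) / 2 ^ m : ℝ≥0) : WithTop ℝ≥0)} := by
    ext ω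
    simp only [mem_inter_iff, mem_ofPred_eq, Set.mem_sdiff, and_assoc, not_lt]
    refine and_congr_right fun h ↦ ?_
    rw [← coe_arrivalTime (jumpTime_ne_top_iff.1 h.ne_top), WithTop.coe_lt_coe, WithTop.coe_le_coe,
      lt_div_iff₀ hpow, div_le_iff₀ hpow, Nat.floor_eq_iff zero_le, mul_comm, and_comm]
    push_cast
    rfl
  rw [this]
  refine (measurableSet_jumpTime_lt_stoppingTime hX hN hτ j _).diff
    (hN.measurableSet_jumpTime_lt hX j ?_)
  gcongr
  simp

lemma nullMeasurableSet_of_completedPairFiltration (hX : ∀ t, Measurable (X t))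
    (hN : ∀ t, Measurable (N t)) {q : ℝ≥0} {E : Set Ω}
    (hE : MeasurableSet[completedPairFiltration μ X N hX hN q] E) : NullMeasurableSet E μ :=
  (completedPairFiltration μ X N hX hN).le q E hE

lemma nullMeasurableSet_jumpTime_lt_stoppingTime (hX : ∀ t, Measurable (X t))
    (hN : IsPoissonProcess N c μ) {τ : Ω → WithTop ℝ≥0}
    (hτ : IsStoppingTime (enlargedPairFiltration μ X N hX hN.measurable) τ) (j : ℕ) :
    NullMeasurableSet {ω | jumpTime N j ω < τ ω} μ := by
  have : {ω | jumpTime N j ω < τ ω} = ⋃ i : ℕ,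
      ({ω | jumpTime N j ω < τ ω} ∩ {ω | ⌊2 ^ 0 * arrivalTime N j ω⌋₊ = i}) := by
    ext ω; simp
  rw [this]
  exact NullMeasurableSet.iUnion fun i ↦ nullMeasurableSet_of_completedPairFiltration hX
    hN.measurable (measurableSet_jumpTime_dyadic hX hN hτ j 0 i)

/-- If `j` jumps are counted at time `q`, the next one after `q` is jump `j + 1`. -/
lemma dyadicRight_add_waitingTime (hN : IsPoissonProcess N c μ) {j : ℕ} {q : ℝ≥0} {ω : Ω}
    (hfin : ∃ t, j + 1 ≤ N t ω) (hq : N q ω = j) :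
    q + waitingTime N q ω = arrivalTime N (j + 1) ω := by
  have hex : ∃ s, 1 ≤ N (q + s) ω - N q ω := by
    obtain ⟨t, ht⟩ := hfin
    refine ⟨t, ?_⟩
    have := hN.mono ω (show t ≤ q + t from le_add_self)
    simp only at this
    omega
  refine eq_of_forall_ge_iff fun t ↦ ?_
  rw [arrivalTime_le_iff hN.mono hN.rightContinuous hfin]
  rcases le_total q t with hqt | hqt
  · obtain ⟨s, rfl⟩ := exists_add_of_le hqt
    rw [add_le_add_iff_left]
    have := arrivalTime_le_iff (hN.shift_mono q) (hN.shift_rightContinuous q) hex (t := s)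
    exact this.trans (by omega)
  · have h1 := hN.mono ω hqt
    simp only at h1
    refine ⟨fun h ↦ ?_, fun h ↦ by omega⟩
    have h2 : waitingTime N q ω ≤ 0 := by
      have : q + waitingTime N q ω ≤ q + 0 := by simpa using h.trans hqt
      exact (add_le_add_iff_left q).1 this
    have := (arrivalTime_le_iff (hN.shift_mono q) (hN.shift_rightContinuous q) hex (t := 0)).1 h2
    simp at this

/-- The dyadic time takes countably many values. On each piece it is deterministic and the event is
known by then, so the Markov property at fixed times can be summed. -/
lemma setIntegral_dyadicRight [IsProbabilityMeasure μ] (hX : IsLevyProcess X μ)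
    (hN : IsPoissonProcess N c μ) (hc : 0 < c)
    (hXN : IndepFun (fun ω t ↦ X t ω) (fun ω t ↦ N t ω) μ) {ξ : Ω → ℝ≥0}
    (hξ : HasLaw (fun ω ↦ (ξ ω : ℝ)) (expMeasure c) μ)
    (hξX : IndepFun ξ (fun ω t ↦ X t ω) μ) (hmeas : AEMeasurable (fun ω ↦ X (ξ ω) ω) μ)
    {τ : Ω → WithTop ℝ≥0}
    (hτ : IsStoppingTime (enlargedPairFiltration μ X N hX.measurable hN.measurable) τ) (j : ℕ)
    {φ : ℝ → ℝ} {B : ℝ} (hφ : Continuous φ) (hB : ∀ x, |φ x| ≤ B) (x : ℝ) (m : ℕ) :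
    let d : Ω → ℝ≥0 := fun ω ↦ dyadicRight m (arrivalTime N j ω)
    AEStronglyMeasurable (fun ω ↦ φ (x + X (d ω + waitingTime N (d ω) ω) ω)) μ ∧
    AEStronglyMeasurable (fun ω ↦ ∫ u, φ (x + X (d ω) ω + u) ∂(μ.map fun ω ↦ X (ξ ω) ω)) μ ∧
    ∫ ω in {ω | jumpTime N j ω < τ ω}, φ (x + X (d ω + waitingTime N (d ω) ω) ω) ∂μ =
      ∫ ω in {ω | jumpTime N j ω < τ ω},
        ∫ u, φ (x + X (d ω) ω + u) ∂(μ.map fun ω ↦ X (ξ ω) ω) ∂μ := by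
  intro d
  set ν := μ.map fun ω ↦ X (ξ ω) ω with hν
  have hνp : IsProbabilityMeasure ν := Measure.isProbabilityMeasure_map hmeas
  have hT := measurable_arrivalTime hN.measurable hN.mono hN.rightContinuous j
  have hfl : Measurable fun ω ↦ ⌊2 ^ m * arrivalTime N j ω⌋₊ :=
    Nat.measurable_floor.comp (hT.const_mul _)
  have hPφ : Continuous fun y ↦ ∫ u, φ (y + u) ∂ν := continuous_integral_add ν hφ hB
  have hcount : ∀ g : ℝ≥0 → Ω → ℝ, (∀ q, Measurable (g q)) → Measurable fun ω ↦ g (d ω) ω := by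
    intro g hg
    have h1 : Measurable fun p : Ω × ℕ ↦ g ((p.2 + 1 : ℕ) / 2 ^ m) p.1 :=
      measurable_from_prod_countable_left fun i ↦ hg ((i + 1 : ℕ) / 2 ^ m)
    have h2 : Measurable fun ω ↦ (ω, ⌊2 ^ m * arrivalTime N j ω⌋₊) := measurable_id.prodMk hfl
    have h3 := h1.comp h2
    simp only [Function.comp_def] at h3
    simpa only [d, dyadicRight] using h3
  have hm1 : Measurable fun ω ↦ φ (x + X (d ω + waitingTime N (d ω) ω) ω) := by
    refine hcount (fun q ω ↦ φ (x + X (q + waitingTime N q ω) ω)) fun q ↦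
      hφ.measurable.comp (Measurable.const_add ?_ x)
    exact measurable_eval_of_rightContinuous hX.measurable hX.rightContinuous
      ((measurable_waitingTime hN q).const_add q)
  have hm2 : Measurable fun ω ↦ ∫ u, φ (x + X (d ω) ω + u) ∂ν :=
    hcount (fun q ω ↦ ∫ u, φ (x + X q ω + u) ∂ν) fun q ↦
      hPφ.measurable.comp ((hX.measurable q).const_add x)
  refine ⟨hm1.aestronglyMeasurable, hm2.aestronglyMeasurable, ?_⟩
  have hi1 : Integrable (fun ω ↦ φ (x + X (d ω + waitingTime N (d ω) ω) ω)) μ :=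
    Integrable.of_bound hm1.aestronglyMeasurable B (ae_of_all _ fun _ ↦ hB _)
  have hi2 : Integrable (fun ω ↦ ∫ u, φ (x + X (d ω) ω + u) ∂ν) μ :=
    Integrable.of_bound hm2.aestronglyMeasurable B (ae_of_all _ fun _ ↦ abs_integral_add_le hB _)
  set E : ℕ → Set Ω := fun i ↦
    {ω | jumpTime N j ω < τ ω} ∩ {ω | ⌊2 ^ m * arrivalTime N j ω⌋₊ = i} with hE
  have hEm := fun i ↦ measurableSet_jumpTime_dyadic hX.measurable hN hτ j m i
  have hUnion : {ω | jumpTime N j ω < τ ω} = ⋃ i, E i := by ext ω; simp [hE]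
  have hdisj : Pairwise (Function.onFun (AEDisjoint μ) E) := fun i i' hii' ↦ by
    refine Disjoint.aedisjoint (Set.disjoint_left.2 fun ω h h' ↦ hii' ?_)
    exact h.2.symm.trans h'.2
  have hnull : ∀ i, NullMeasurableSet (E i) μ := fun i ↦
    nullMeasurableSet_of_completedPairFiltration hX.measurable hN.measurable (hEm i)
  rw [hUnion, integral_iUnion_ae hnull hdisj hi1.integrableOn,
    integral_iUnion_ae hnull hdisj hi2.integrableOn]
  refine tsum_congr fun i ↦ ?_
  have hd : ∀ ω ∈ E i, d ω = (i + 1 : ℕ) / 2 ^ m := fun ω hω ↦ by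
    have : ⌊2 ^ m * arrivalTime N j ω⌋₊ = i := hω.2
    simp only [d, dyadicRight, this]
  rw [setIntegral_congr_fun₀ (hnull i) (g := fun ω ↦ φ (x + X ((i + 1 : ℕ) / 2 ^ m +
      waitingTime N ((i + 1 : ℕ) / 2 ^ m) ω) ω)) (fun ω hω ↦ by simp only [hd ω hω]),
    setIntegral_congr_fun₀ (hnull i) (f := fun ω ↦ ∫ u, φ (x + X (d ω) ω + u) ∂ν)
      (g := fun ω ↦ ∫ u, φ (x + X ((i + 1 : ℕ) / 2 ^ m) ω + u) ∂ν)
      (fun ω hω ↦ by simp only [hd ω hω])]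
  exact setIntegral_nextIncrement hX hN hc hXN hξ hξX hmeas _ (hEm i) hφ hB x

/-- The strong Markov property at the jump times, on the event that `τ` has not stopped yet. -/
theorem setIntegral_arrivalTime_succ [IsProbabilityMeasure μ] (hX : IsLevyProcess X μ)
    (hN : IsPoissonProcess N c μ) (hc : 0 < c)
    (hXN : IndepFun (fun ω t ↦ X t ω) (fun ω t ↦ N t ω) μ) {ξ : Ω → ℝ≥0}
    (hξ : HasLaw (fun ω ↦ (ξ ω : ℝ)) (expMeasure c) μ)
    (hξX : IndepFun ξ (fun ω t ↦ X t ω) μ) (hmeas : AEMeasurable (fun ω ↦ X (ξ ω) ω) μ)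
    {τ : Ω → WithTop ℝ≥0}
    (hτ : IsStoppingTime (enlargedPairFiltration μ X N hX.measurable hN.measurable) τ) (j : ℕ)
    {φ : ℝ → ℝ} {B : ℝ} (hφ : Continuous φ) (hB : ∀ x, |φ x| ≤ B) (x : ℝ) :
    ∫ ω in {ω | jumpTime N j ω < τ ω}, φ (x + X (arrivalTime N (j + 1) ω) ω) ∂μ =
      ∫ ω in {ω | jumpTime N j ω < τ ω},
        ∫ u, φ (x + X (arrivalTime N j ω) ω + u) ∂(μ.map fun ω ↦ X (ξ ω) ω) ∂μ := by
  set ν := μ.map fun ω ↦ X (ξ ω) ω with hν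
  have hνp : IsProbabilityMeasure ν := Measure.isProbabilityMeasure_map hmeas
  have hPφ : Continuous fun y ↦ ∫ u, φ (y + u) ∂ν := continuous_integral_add ν hφ hB
  have happrox := setIntegral_dyadicRight hX hN hc hXN hξ hξX hmeas hτ j hφ hB x
  have hd : ∀ ω, Tendsto (fun m ↦ dyadicRight m (arrivalTime N j ω)) atTop
      (𝓝[>] (arrivalTime N j ω)) := fun ω ↦ tendsto_dyadicRight _
  have hXd : ∀ ω, Tendsto (fun m ↦ X (dyadicRight m (arrivalTime N j ω)) ω) atTop
      (𝓝 (X (arrivalTime N j ω) ω)) := fun ω ↦ (hX.rightContinuous ω _).tendsto.comp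
    ((hd ω).mono_right (nhdsWithin_mono _ Ioi_subset_Ici_self))
  refine tendsto_nhds_unique (tendsto_integral_of_dominated_convergence (fun _ ↦ B)
    (fun m ↦ (happrox m).1.restrict) (integrable_const _)
    (fun m ↦ ae_of_all _ fun ω ↦ hB _) ?_) ?_
  · refine ae_restrict_of_ae ?_
    filter_upwards [hN.ae_exists_le hc, hN.ae_strictMono_arrivalTime hc] with ω hfin hmono
    have hlt : arrivalTime N j ω < arrivalTime N (j + 1) ω := hmono (Nat.lt_succ_self j)
    have hev : ∀ᶠ m in atTop,
        dyadicRight m (arrivalTime N j ω) < arrivalTime N (j + 1) ω :=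
      ((hd ω).mono_right nhdsWithin_le_nhds).eventually (gt_mem_nhds hlt)
    -- Once the dyadic time precedes `T_{j+1}`, the next jump after it is `T_{j+1}` itself, so the
    -- left integrand is eventually constant in `m`.
    refine tendsto_const_nhds.congr' (hev.mono fun m hm ↦ ?_)
    have h1 : j ≤ N (dyadicRight m (arrivalTime N j ω)) ω :=
      (arrivalTime_le_iff hN.mono hN.rightContinuous (hfin j)).1 (lt_dyadicRight m _).le
    have h2 : ¬ j + 1 ≤ N (dyadicRight m (arrivalTime N j ω)) ω := fun h ↦
      not_le.2 hm ((arrivalTime_le_iff hN.mono hN.rightContinuous (hfin (j + 1))).2 h)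
    simp only
    rw [dyadicRight_add_waitingTime hN (hfin (j + 1)) (by omega)]
  · simp only [fun m ↦ (happrox m).2.2]
    refine tendsto_integral_of_dominated_convergence (fun _ ↦ B)
      (fun m ↦ (happrox m).2.1.restrict) (integrable_const _)
      (fun m ↦ ae_of_all _ fun ω ↦ abs_integral_add_le hB _) (ae_of_all _ fun ω ↦ ?_)
    exact (hPφ.tendsto _).comp ((hXd ω).const_add x)

end strongMarkov

/-! ### Support of the step law -/

section levySupport

variable {Ω : Type*} [mΩ : MeasurableSpace Ω] {μ : Measure Ω} {X : ℝ≥0 → Ω → ℝ}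

lemma aemeasurable_eval_independent_time (hX : IsLevyProcess X μ) {ξ : Ω → ℝ≥0}
    (hξ : AEMeasurable ξ μ) : AEMeasurable (fun ω ↦ X (ξ ω) ω) μ := by
  refine ⟨fun ω ↦ X (hξ.mk ξ ω) ω, measurable_eval_of_rightContinuous hX.measurable
    hX.rightContinuous hξ.measurable_mk, ?_⟩
  filter_upwards [hξ.ae_eq_mk] with ω hω
  rw [← hω]

/-- By right continuity, an open set that is not charged at times arbitrarily close to the right
of `t` is not charged at `t`. -/
lemma IsLevyProcess.measure_eq_zero_of_frequently (hX : IsLevyProcess X μ) {U : Set ℝ}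
    (hU : IsOpen U) {t : ℝ≥0}
    (h : ∀ ε, 0 < ε → ∃ s, t < s ∧ s < t + ε ∧ μ {ω | X s ω ∈ U} = 0) :
    μ {ω | X t ω ∈ U} = 0 := by
  choose s hs1 hs2 hs0 using fun i : ℕ ↦ h (1 / ((i : ℝ≥0) + 1)) (by positivity)
  have hs : Tendsto s atTop (𝓝[≥] t) := by
    refine tendsto_nhdsWithin_iff.2 ⟨?_, .of_forall fun i ↦ (hs1 i).le⟩
    refine tendsto_of_tendsto_of_tendsto_of_le_of_le tendsto_const_nhds
      (h := fun i : ℕ ↦ t + 1 / ((i : ℝ≥0) + 1)) ?_ (fun i ↦ (hs1 i).le) (fun i ↦ (hs2 i).le)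
    simpa using tendsto_const_nhds.add (tendsto_one_div_add_atTop_nhds_zero_nat (𝕜 := ℝ≥0))
  refine measure_mono_null (t := ⋃ i, {ω | X (s i) ω ∈ U}) (fun ω hω ↦ ?_)
    (measure_iUnion_null hs0)
  have := ((hX.rightContinuous ω t).tendsto.comp hs).eventually (hU.mem_nhds hω)
  obtain ⟨i, hi⟩ := this.exists
  exact mem_iUnion.2 ⟨i, hi⟩

lemma expMeasure_Ioo_pos {c a b : ℝ} (hc : 0 < c) (ha : 0 ≤ a) (hab : a < b) :
    0 < expMeasure c (Ioo a b) := by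
  have : IsProbabilityMeasure (expMeasure c) := isProbabilityMeasure_expMeasure hc
  obtain ⟨b', hab', hb'⟩ := exists_between hab
  refine lt_of_lt_of_le ?_ (measure_mono (fun x hx ↦ ⟨hx.1, hx.2.trans_lt hb'⟩ :
    Ioc a b' ⊆ Ioo a b))
  rw [← measure_cdf (expMeasure c), StieltjesFunction.measure_Ioc, ENNReal.ofReal_pos,
    cdf_expMeasure_eq hc, cdf_expMeasure_eq hc, if_pos ha, if_pos (ha.trans hab'.le)]
  have : Real.exp (-(c * b')) < Real.exp (-(c * a)) := Real.exp_lt_exp.2 (by nlinarith)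
  linarith

lemma IsLevyProcess.measure_increment_mem (hX : IsLevyProcess X μ) (s t : ℝ≥0) {A : Set ℝ}
    (hA : MeasurableSet A) : μ {ω | X (s + t) ω - X s ω ∈ A} = μ {ω | X t ω ∈ A} := by
  refine ((hX.stationaryIncrements s t).measure_mem_eq hA).trans (measure_congr ?_)
  filter_upwards [hX.zero] with ω hω
  apply propext
  change X t ω - X 0 ω ∈ A ↔ X t ω ∈ A
  rw [hω, sub_zero]

/-- If `A + B ⊆ C`, then `ℙ(X_s ∈ A) ℙ(X_t ∈ B) ≤ ℙ(X_{s+t} ∈ C)`. -/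
lemma IsLevyProcess.measure_mul_le (hX : IsLevyProcess X μ) (s t : ℝ≥0) {A B C : Set ℝ}
    (hA : MeasurableSet A) (hB : MeasurableSet B) (h : ∀ a ∈ A, ∀ b ∈ B, a + b ∈ C) :
    μ {ω | X s ω ∈ A} * μ {ω | X t ω ∈ B} ≤ μ {ω | X (s + t) ω ∈ C} := by
  have hind : IndepFun (X s) (X (s + t) - X s) μ :=
    hX.indepIncrements.indepFun_eval_sub zero_le le_self_add hX.zero
  rw [← hX.measure_increment_mem s t hB]
  refine (hind.measure_inter_preimage_eq_mul A B hA hB).symm.le.trans (measure_mono ?_)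
  rintro ω ⟨h1, h2⟩
  have := h _ h1 _ h2
  simpa using this

variable {ξ : Ω → ℝ≥0} {c : ℝ}

/-- Were `U` not charged, almost every marginal would miss it. The exponential law charges every
interval to the right of `t`, so such times accumulate there, and right continuity would make `X_t`
miss `U` too. -/
lemma map_eval_pos [IsProbabilityMeasure μ] (hX : IsLevyProcess X μ) (hc : 0 < c)
    (hξ : HasLaw (fun ω ↦ (ξ ω : ℝ)) (expMeasure c) μ)
    (hξX : IndepFun ξ (fun ω t ↦ X t ω) μ) {U : Set ℝ} (hU : IsOpen U) {t : ℝ≥0}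
    (h : 0 < μ {ω | X t ω ∈ U}) : 0 < (μ.map fun ω ↦ X (ξ ω) ω) U := by
  have hξm := aemeasurable_of_hasLaw_coe hξ
  rw [Measure.map_apply_of_aemeasurable (aemeasurable_eval_independent_time hX hξm)
    hU.measurableSet]
  have e := measure_eval_of_indepFun_path hX.measurable hX.rightContinuous hξm hξX hU.measurableSet
  refine pos_iff_ne_zero.2 fun h0 ↦ h.ne' (hX.measure_eq_zero_of_frequently hU fun ε hε ↦ ?_)
  have hm : Measurable fun t ↦ μ {ω | X t ω ∈ U} :=
    measurable_measure_prodMk_right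
      (measurable_uncurry_of_rightContinuous hX.measurable hX.rightContinuous hU.measurableSet)
  have hae : ∀ᵐ s ∂(μ.map ξ), μ {ω | X s ω ∈ U} = 0 :=
    (lintegral_eq_zero_iff hm).1 (e.symm.trans h0)
  have hpos : 0 < μ.map ξ (Ioo t (t + ε)) := by
    rw [Measure.map_apply_of_aemeasurable hξm measurableSet_Ioo]
    have h1 := expMeasure_Ioo_pos hc t.2 (show (t : ℝ) < t + ε by simpa using hε)
    rw [← hξ.map_eq, Measure.map_apply_of_aemeasurable hξ.aemeasurable measurableSet_Ioo] at h1
    refine h1.trans_le (measure_mono fun ω hω ↦ ⟨?_, ?_⟩)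
    · exact NNReal.coe_lt_coe.1 hω.1
    · exact NNReal.coe_lt_coe.1 (by push_cast; exact hω.2)
  by_contra! hcon
  refine hpos.ne' (measure_mono_null (fun s hs ↦ ?_) (ae_iff.1 hae))
  exact hcon s hs.1 hs.2

lemma IsLevyProcess.measure_nat_mul_Iio_pos (hX : IsLevyProcess X μ) {t : ℝ≥0} {ε : ℝ}
    (h : 0 < μ {ω | X t ω ∈ Iio (-ε)}) (k : ℕ) :
    0 < μ {ω | X ((k + 1 : ℕ) * t) ω ∈ Iio (-((k + 1 : ℕ) * ε))} := by
  induction k with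
  | zero => simpa using h
  | succ k ih =>
    have h1 := (ENNReal.mul_pos ih.ne' h.ne').trans_le (hX.measure_mul_le ((k + 1 : ℕ) * t) t
      (C := Iio (-((k + 1 + 1 : ℕ) * ε))) measurableSet_Iio measurableSet_Iio
      fun a ha b hb ↦ by
        have := mem_Iio.1 ha
        have := mem_Iio.1 hb
        rw [mem_Iio]; push_cast at *; linarith)
    have h2 : ((k + 1 : ℕ) : ℝ≥0) * t + t = ((k + 1 + 1 : ℕ) : ℝ≥0) * t := by push_cast; ring
    rwa [h2] at h1

/-- A Lévy process that takes negative values at time `1` is unbounded below. -/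
lemma IsLevyProcess.exists_measure_Iio_pos (hX : IsLevyProcess X μ)
    (hneg : 0 < μ {ω | X 1 ω < 0}) (a : ℝ) : ∃ t, 0 < μ {ω | X t ω ∈ Iio a} := by
  obtain ⟨ε, hε, hpos⟩ : ∃ ε : ℝ, 0 < ε ∧ 0 < μ {ω | X 1 ω ∈ Iio (-ε)} := by
    by_contra! hcon
    refine hneg.ne' (measure_mono_null (t := ⋃ i : ℕ, {ω | X 1 ω ∈ Iio (-(1 / ((i : ℝ) + 1)))})
      (fun ω hω ↦ ?_) (measure_iUnion_null fun i ↦ ?_))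
    · obtain ⟨i, hi⟩ := exists_nat_one_div_lt (show 0 < -X 1 ω from neg_pos.2 hω)
      exact mem_iUnion.2 ⟨i, by simp only [mem_ofPred_eq, mem_Iio]; linarith⟩
    · exact le_antisymm (hcon _ (by positivity)) zero_le
  obtain ⟨k, hk⟩ := exists_nat_gt (-a / ε)
  refine ⟨(k + 1 : ℕ) * 1,
    (hX.measure_nat_mul_Iio_pos hpos k).trans_le (measure_mono fun ω hω ↦ ?_)⟩
  have h1 : X ((k + 1 : ℕ) * 1) ω < -((k + 1 : ℕ) * ε) := hω
  rw [div_lt_iff₀ hε] at hk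
  refine mem_Iio.2 (h1.trans_le ?_)
  push_cast
  linarith

lemma IsLevyProcess.measure_nat_mul_Ioi_pos (hX : IsLevyProcess X μ) {t : ℝ≥0}
    (h : 0 < μ {ω | X t ω ∈ Ioi 0}) (k : ℕ) :
    0 < μ {ω | X ((k + 1 : ℕ) * t) ω ∈ Ioi 0} := by
  induction k with
  | zero => simpa using h
  | succ k ih =>
    have h1 := (ENNReal.mul_pos ih.ne' h.ne').trans_le (hX.measure_mul_le ((k + 1 : ℕ) * t) t
      (C := Ioi 0) measurableSet_Ioi measurableSet_Ioi
      fun a ha b hb ↦ mem_Ioi.2 (add_pos (mem_Ioi.1 ha) (mem_Ioi.1 hb)))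
    have h2 : ((k + 1 : ℕ) : ℝ≥0) * t + t = ((k + 1 + 1 : ℕ) : ℝ≥0) * t := by push_cast; ring
    rwa [h2] at h1

/-- If `X_1 ≤ 0` almost surely, then `X_t ≤ 0` almost surely for every `t`. -/
lemma IsLevyProcess.measure_Ioi_eq_zero (hX : IsLevyProcess X μ)
    (h : μ {ω | 0 < X 1 ω} = 0) (t : ℝ≥0) : μ {ω | X t ω ∈ Ioi 0} = 0 := by
  have hnat : ∀ i : ℕ, μ {ω | X i ω ∈ Ioi 0} = 0 := by
    intro i
    induction i with
    | zero =>
      refine measure_mono_null (fun ω hω ↦ ?_) (ae_iff.1 hX.zero)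
      intro hω0
      have : 0 < X ((0 : ℕ) : ℝ≥0) ω := hω
      rw [Nat.cast_zero, hω0] at this
      exact lt_irrefl _ this
    | succ i ih =>
      have h1 := hX.measure_increment_mem i 1 (measurableSet_Ioi (a := (0 : ℝ)))
      refine measure_mono_null (t := {ω | X i ω ∈ Ioi 0} ∪ {ω | X (i + 1) ω - X i ω ∈ Ioi 0})
        (fun ω hω ↦ ?_) (measure_union_null ih (h1.trans h))
      have hω' : 0 < X ((i + 1 : ℕ) : ℝ≥0) ω := hω
      push_cast at hω'
      by_contra hcon
      simp only [mem_union, mem_ofPred_eq, mem_Ioi, not_or, not_lt] at hcon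
      linarith [hcon.1, hcon.2]
  refine hX.measure_eq_zero_of_frequently isOpen_Ioi fun ε hε ↦ ?_
  obtain ⟨p, hp1, hp2⟩ := exists_dyadic_between (show t < t + ε from lt_add_of_pos_right t hε)
  refine ⟨_, hp1, hp2, ?_⟩
  by_contra hcon
  -- Positivity at the dyadic time would persist at its multiple by `2 ^ p.1`, the integer `p.2`.
  -- The `- 1` offsets the index `k + 1` of the lemma.
  refine (hX.measure_nat_mul_Ioi_pos (pos_iff_ne_zero.2 hcon) (2 ^ p.1 - 1)).ne' ?_
  have h2 : ((2 ^ p.1 - 1 + 1 : ℕ) : ℝ≥0) * (p.2 / 2 ^ p.1) = (p.2 : ℝ≥0) := by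
    rw [Nat.sub_add_cancel Nat.one_le_two_pow]
    push_cast
    field_simp
  rw [h2]
  exact hnat p.2

end levySupport

/-! ### Reduction of the grid problem to the random walk -/

section gridValue

variable {Ω : Type*} {X : ℝ≥0 → Ω → ℝ} {N : ℝ≥0 → Ω → ℕ}

/-- On the almost sure event of finite, strictly increasing jump times, the stopped discounted
payoff only depends on the index of the jump time. -/
lemma gridDiscount_mul_stoppedValue {ω : Ω} (hfin : ∀ k, ∃ t, k ≤ N t ω)
    (hmono : StrictMono fun k ↦ arrivalTime N k ω) {τ : Ω → WithTop ℝ≥0} {i : ℕ}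
    (hi : τ ω = jumpTime N i ω) (r : ℝ) (n k : ℕ) (f : ℝ → ℝ) (x : ℝ) :
    gridDiscount N r n (fun ω' ↦ min (τ ω') (jumpTime N k ω')) ω *
      f (stoppedValue (fun t ω' ↦ x + X t ω') (fun ω' ↦ min (τ ω') (jumpTime N k ω')) ω) =
    Real.exp (-r / n) ^ (min i k) * f (x + X (arrivalTime N (min i k) ω) ω) := by
  have hmin : min (τ ω) (jumpTime N k ω) = jumpTime N (min i k) ω := by
    rw [hi]; exact ((jumpTime_mono ω).map_min).symm
  have hinj : ∀ l, jumpTime N (min i k) ω = jumpTime N l ω → l = min i k := by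
    intro l hl
    rw [← coe_arrivalTime (hfin _), ← coe_arrivalTime (hfin _), WithTop.coe_inj] at hl
    exact (hmono.injective hl).symm
  have hdisc : gridDiscount N r n (fun ω' ↦ min (τ ω') (jumpTime N k ω')) ω =
      Real.exp (-r / n) ^ (min i k) := by
    unfold gridDiscount
    rw [tsum_eq_single (min i k)]
    · rw [indicator_of_mem (show ω ∈ {ω' | min (τ ω') (jumpTime N k ω') =
        jumpTime N (min i k) ω'} from hmin), ← Real.exp_nat_mul]
      congr 1
      ring
    · intro l hl
      refine indicator_of_notMem (fun h ↦ hl (hinj l ?_)) _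
      exact hmin.symm.trans h
  rw [hdisc, stoppedValue, hmin]
  rfl

variable [mΩ : MeasurableSpace Ω] {μ : Measure Ω} {c : ℝ≥0} {q K : ℝ} {ξ : Ω → ℝ≥0}

/-- The expected payoff of a grid-valued stopping time along its index `ι`. -/
lemma integral_indexed_payoff [IsProbabilityMeasure μ] (hX : IsLevyProcess X μ) (hN : IsPoissonProcess N c μ) (hc : 0 < c)
    (hXN : IndepFun (fun ω t ↦ X t ω) (fun ω t ↦ N t ω) μ)
    (hξ : HasLaw (fun ω ↦ (ξ ω : ℝ)) (expMeasure c) μ)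
    (hξX : IndepFun ξ (fun ω t ↦ X t ω) μ) (hq0 : 0 < q) (hq1 : q < 1) (hK : 0 < K)
    {τ : Ω → WithTop ℝ≥0}
    (hτ : IsStoppingTime (enlargedPairFiltration μ X N hX.measurable hN.measurable) τ)
    {ι : Ω → ℕ} (hι : ∀ ω, τ ω = jumpTime N (ι ω) ω) (k : ℕ) (x : ℝ) :
    let ν := μ.map fun ω ↦ X (ξ ω) ω
    let Y : ℕ → Ω → ℝ := fun j ω ↦ x + X (arrivalTime N j ω) ω
    ∫ ω, q ^ (min (ι ω) k) * putPayoff K (Y (min (ι ω) k) ω) ∂μ ≤ walkValue ν q K k x ∧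
    ((∀ i < k, stoppingLoss ν q K Y ι k i =ᵐ[μ] 0) →
      ∫ ω, q ^ (min (ι ω) k) * putPayoff K (Y (min (ι ω) k) ω) ∂μ = walkValue ν q K k x) := by
  intro ν Y
  have hmeas := aemeasurable_eval_independent_time hX (aemeasurable_of_hasLaw_coe hξ)
  have hνp : IsProbabilityMeasure ν := Measure.isProbabilityMeasure_map hmeas
  have hlt : ∀ j, ({ω | j < ι ω} : Set Ω) =ᵐ[μ] ({ω | jumpTime N j ω < τ ω} : Set Ω) := by
    intro j
    filter_upwards [hN.ae_exists_le hc, hN.ae_strictMono_arrivalTime hc] with ω hfin hmono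
    apply propext
    change j < ι ω ↔ jumpTime N j ω < τ ω
    rw [hι, ← coe_arrivalTime (hfin _), ← coe_arrivalTime (hfin _), WithTop.coe_lt_coe]
    exact hmono.lt_iff_lt.symm
  -- `ι` is an arbitrary selection of indices; its measurability holds only up to null sets and
  -- comes from the events `T_j < τ`.
  have hιm : AEMeasurable ι μ := by
    have hnull : ∀ j, NullMeasurableSet (ι ⁻¹' Ioi j) μ := fun j ↦
      (nullMeasurableSet_jumpTime_lt_stoppingTime hX.measurable hN hτ j).congr (hlt j).symm
    refine NullMeasurable.aemeasurable fun s _ ↦ ?_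
    have hsing : ∀ j, NullMeasurableSet (ι ⁻¹' {j}) μ := by
      intro j
      cases j with
      | zero =>
        have : ι ⁻¹' {0} = (ι ⁻¹' Ioi 0)ᶜ := by ext ω; simp
        rw [this]; exact (hnull 0).compl
      | succ j =>
        have : ι ⁻¹' {j + 1} = ι ⁻¹' Ioi j \ ι ⁻¹' Ioi (j + 1) := by
          ext ω
          simp only [mem_preimage, mem_singleton_iff, Set.mem_sdiff, mem_Ioi]
          omega
        rw [this]; exact (hnull j).diff (hnull (j + 1))
    have : ι ⁻¹' s = ⋃ j ∈ s, ι ⁻¹' {j} := by ext ω; simp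
    rw [this]
    exact NullMeasurableSet.biUnion s.to_countable fun j _ ↦ hsing j
  have hY : ∀ j, AEMeasurable (Y j) μ := fun j ↦
    ((measurable_eval_of_rightContinuous hX.measurable hX.rightContinuous
      (measurable_arrivalTime hN.measurable hN.mono hN.rightContinuous j)).const_add x).aemeasurable
  have hY0 : ∀ᵐ ω ∂μ, Y 0 ω = x := by
    filter_upwards [hX.zero] with ω hω
    simp only [Y, arrivalTime_zero, hω, add_zero]
  have hmain := integral_interpolatedPayoff (k := k) (j := k) hq0 hq1 hK hY hY0 hιm
    (fun j φ M hφ hM ↦ by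
      rw [setIntegral_congr_set (hlt j), setIntegral_congr_set (hlt j)]
      exact setIntegral_arrivalTime_succ hX hN hc hXN hξ hξX hmeas hτ j hφ hM x) le_rfl
  simp only [interpolatedPayoff_self] at hmain
  exact hmain.2

/-- The first jump index at which the payoff reaches the value function. -/
noncomputable def firstExerciseIndex (ν : Measure ℝ) (q K : ℝ) (k : ℕ) (Y : ℕ → ℝ) : ℕ :=
  sInf {j | walkValue ν q K (k - j) (Y j) = putPayoff K (Y j)}

/-- The infimum is attained because index `k` always qualifies, the value at level `0` being the
payoff. -/
lemma firstExerciseIndex_spec (ν : Measure ℝ) (q K : ℝ) (k : ℕ) (Y : ℕ → ℝ) :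
    walkValue ν q K (k - firstExerciseIndex ν q K k Y) (Y (firstExerciseIndex ν q K k Y)) =
      putPayoff K (Y (firstExerciseIndex ν q K k Y)) :=
  Nat.sInf_mem (s := {j | walkValue ν q K (k - j) (Y j) = putPayoff K (Y j)})
    ⟨k, by simp only [mem_ofPred_eq, Nat.sub_self]; rfl⟩

/-- When the rule stops, value and payoff agree; before that they differ, so the maximum defining
the value is the continuation. -/
lemma stoppingLoss_firstExerciseIndex {Ω : Type*} (ν : Measure ℝ) (q K : ℝ) (k : ℕ)
    (Y : ℕ → Ω → ℝ) {j : ℕ} (hj : j < k) :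
    stoppingLoss ν q K Y (fun ω ↦ firstExerciseIndex ν q K k fun i ↦ Y i ω) k j = 0 := by
  funext ω
  unfold stoppingLoss
  simp only [Pi.add_apply, Pi.zero_apply, indicator_apply, mem_ofPred_eq]
  rcases lt_trichotomy (firstExerciseIndex ν q K k fun i ↦ Y i ω) j with h | h | h
  · rw [if_neg (by omega), if_neg (by omega), add_zero]
  · rw [if_pos h, if_neg (by omega), add_zero]
    have := firstExerciseIndex_spec ν q K k fun i ↦ Y i ω
    rw [h] at this
    rw [this, sub_self, mul_zero]
  · rw [if_neg (by omega), if_pos h, zero_add]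
    have hne : walkValue ν q K (k - j) (Y j ω) ≠ putPayoff K (Y j ω) := Nat.notMem_of_lt_sInf h
    obtain ⟨i, hi⟩ : ∃ i, k - j = i + 1 := ⟨k - j - 1, by omega⟩
    rw [hi] at hne ⊢
    rw [show k - (j + 1) = i by omega]
    rcases max_choice (putPayoff K (Y j ω)) (q * ∫ u, walkValue ν q K i (Y j ω + u) ∂ν) with h | h
    · exact absurd h hne
    · rw [show walkValue ν q K (i + 1) (Y j ω) = _ from h, sub_self, mul_zero]

/-- The σ-algebra generated by `(X, N)` up to time `t`, without completion. -/
abbrev rawPairSpace (X : ℝ≥0 → Ω → ℝ) (N : ℝ≥0 → Ω → ℕ) (t : ℝ≥0) : MeasurableSpace Ω :=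
  ⨆ s ≤ t, MeasurableSpace.comap (fun ω ↦ (X s ω, N s ω)) inferInstance

/-- Freezing both processes at `t` makes the arrival times and sampled values measurable at time
`t`, and nothing changes for jumps already counted by then. -/
lemma isStoppingTime_firstExercise (hX : IsLevyProcess X μ) (hN : IsPoissonProcess N c μ)
    {ν : Measure ℝ} [IsProbabilityMeasure ν] (hq0 : 0 < q) (hq1 : q < 1) (hK : 0 < K)
    (k : ℕ) (x : ℝ) :
    IsStoppingTime (enlargedPairFiltration μ X N hX.measurable hN.measurable) fun ω ↦ jumpTime N
      (firstExerciseIndex ν q K k fun j ↦ x + X (arrivalTime N j ω) ω) ω := by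
  intro t
  have hle : rawPairSpace X N t ≤ enlargedPairFiltration μ X N hX.measurable hN.measurable t :=
    le_trans (le_eventuallyMeasurableSpace :
      rawPairSpace X N t ≤ completedPairFiltration μ X N hX.measurable hN.measurable t)
      (Filtration.le_rightCont (completedPairFiltration μ X N hX.measurable hN.measurable) t)
  refine hle _ ?_
  have hXN : ∀ s ≤ t, Measurable[rawPairSpace X N t] fun ω ↦ (X s ω, N s ω) := fun s hs ↦
    (comap_measurable fun ω ↦ (X s ω, N s ω)).mono (le_iSup₂_of_le s hs le_rfl) le_rfl
  have hXt : ∀ s, Measurable[rawPairSpace X N t] (X (min s t)) := fun s ↦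
    measurable_fst.comp (hXN _ (min_le_right s t))
  have hNt : ∀ s, Measurable[rawPairSpace X N t] (N (min s t)) := fun s ↦
    measurable_snd.comp (hXN _ (min_le_right s t))
  have hmin : ∀ (s : ℝ≥0), ContinuousWithinAt (fun u ↦ min u t) (Ici s) s := fun s ↦
    (continuous_id.min continuous_const).continuousWithinAt
  have hmaps : ∀ s : ℝ≥0, MapsTo (fun u ↦ min u t) (Ici s) (Ici (min s t)) := fun s u hu ↦
    min_le_min (mem_Ici.1 hu) le_rfl
  have hXrc : ∀ ω s, ContinuousWithinAt (fun u ↦ X (min u t) ω) (Ici s) s := fun ω s ↦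
    ContinuousWithinAt.comp (f := fun u ↦ min u t) (hX.rightContinuous ω (min s t)) (hmin s) (hmaps s)
  have hNrc : ∀ ω s, ContinuousWithinAt (fun u ↦ N (min u t) ω) (Ici s) s := fun ω s ↦
    ContinuousWithinAt.comp (f := fun u ↦ min u t) (hN.rightContinuous ω (min s t)) (hmin s) (hmaps s)
  have hNmono : ∀ ω, Monotone fun u ↦ N (min u t) ω := fun ω u v huv ↦
    hN.mono ω (min_le_min huv le_rfl)
  set Y' : ℕ → Ω → ℝ := fun j ω ↦
    x + X (min (arrivalTime (fun u ω ↦ N (min u t) ω) j ω) t) ω with hY'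
  have hY'm : ∀ j, Measurable[rawPairSpace X N t] (Y' j) := fun j ↦
    (measurable_eval_of_rightContinuous (m₀ := rawPairSpace X N t) hXt hXrc
      (measurable_arrivalTime (m₀ := rawPairSpace X N t) hNt hNmono hNrc j)).const_add x
  have hYY' : ∀ j ω, j ≤ N t ω → Y' j ω = x + X (arrivalTime N j ω) ω := by
    intro j ω hj
    have hfin : ∃ s, j ≤ N (min s t) ω := ⟨t, by rwa [min_self]⟩
    have h1 : arrivalTime N j ω ≤ t := (arrivalTime_le_iff hN.mono hN.rightContinuous ⟨t, hj⟩).2 hj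
    have h2 : min (arrivalTime (fun u ω ↦ N (min u t) ω) j ω) t = arrivalTime N j ω := by
      refine eq_of_forall_ge_iff fun s ↦ ?_
      rw [arrivalTime_le_iff hN.mono hN.rightContinuous ⟨t, hj⟩, min_le_iff,
        arrivalTime_le_iff hNmono hNrc hfin]
      rcases le_total s t with hst | hst
      · rw [min_eq_left hst]
        refine or_iff_left_of_imp fun hts ↦ ?_
        rwa [le_antisymm hst hts]
      · rw [min_eq_right hst]
        exact ⟨fun _ ↦ hj.trans (hN.mono ω hst), fun _ ↦ Or.inr hst⟩
    simp only [hY', h2]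
  -- The first suitable index has been reached by time `t` exactly when some suitable index has, and
  -- for reached indices the frozen values are the true ones.
  have hset : {ω | jumpTime N (firstExerciseIndex ν q K k fun j ↦ x + X (arrivalTime N j ω) ω) ω
      ≤ (t : WithTop ℝ≥0)} = ⋃ j : ℕ, (N (min t t) ⁻¹' Ici j ∩
        {ω | walkValue ν q K (k - j) (Y' j ω) = putPayoff K (Y' j ω)}) := by
    ext ω
    simp only [mem_ofPred_eq, mem_iUnion, mem_inter_iff, mem_preimage, mem_Ici, min_self]
    rw [jumpTime_le_iff hN.mono hN.rightContinuous]
    constructor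
    · intro h
      refine ⟨_, h, ?_⟩
      rw [hYY' _ ω h]
      exact firstExerciseIndex_spec ν q K k fun j ↦ x + X (arrivalTime N j ω) ω
    · rintro ⟨j, hj, hval⟩
      rw [hYY' j ω hj] at hval
      exact (Nat.sInf_le hval).trans hj
  rw [hset]
  refine MeasurableSet.iUnion fun j ↦ (hNt t measurableSet_Ici).inter ?_
  exact measurableSet_eq_fun
    ((continuous_walkValue hq0 hq1 hK (k - j)).measurable.comp (hY'm j))
    ((continuous_putPayoff K).measurable.comp (hY'm j))

/-- The value of the grid stopping problem is given by backward induction. -/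
theorem gridValue_eq_walkValue [IsProbabilityMeasure μ] {n : ℕ} (hn : 1 ≤ n) {r : ℝ} (hr : 0 < r) (hK : 0 < K)
    (hX : IsLevyProcess X μ) (hN : IsPoissonProcess N (n : ℝ≥0) μ)
    (hXN : IndepFun (fun ω t ↦ X t ω) (fun ω t ↦ N t ω) μ)
    (hξ : HasLaw (fun ω ↦ (ξ ω : ℝ)) (expMeasure (n : ℝ)) μ)
    (hξX : IndepFun ξ (fun ω t ↦ X t ω) μ) (k : ℕ) (x : ℝ) :
    gridValue μ X N hX.measurable hN.measurable r n (putPayoff K) k x =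
      walkValue (μ.map fun ω ↦ X (ξ ω) ω) (Real.exp (-r / n)) K k x := by
  have hc : (0 : ℝ≥0) < n := by exact_mod_cast hn
  have hn' : (0 : ℝ) < n := by exact_mod_cast hn
  have hq1 : Real.exp (-r / n) < 1 :=
    Real.exp_lt_one_iff.2 (div_neg_of_neg_of_pos (neg_lt_zero.2 hr) hn')
  have hξ' : HasLaw (fun ω ↦ (ξ ω : ℝ)) (expMeasure ((n : ℝ≥0) : ℝ)) μ := by simpa using hξ
  have hmeas := aemeasurable_eval_independent_time hX (aemeasurable_of_hasLaw_coe hξ)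
  have hνp : IsProbabilityMeasure (μ.map fun ω ↦ X (ξ ω) ω) := Measure.isProbabilityMeasure_map hmeas
  have hpay : ∀ (τ : Ω → WithTop ℝ≥0) (ι : Ω → ℕ), (∀ ω, τ ω = jumpTime N (ι ω) ω) →
      ∫ ω, gridDiscount N r n (fun ω' ↦ min (τ ω') (jumpTime N k ω')) ω * putPayoff K
        (stoppedValue (fun t ω' ↦ x + X t ω') (fun ω' ↦ min (τ ω') (jumpTime N k ω')) ω) ∂μ =
      ∫ ω, Real.exp (-r / n) ^ (min (ι ω) k) *
        putPayoff K (x + X (arrivalTime N (min (ι ω) k) ω) ω) ∂μ := by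
    intro τ ι hι
    refine integral_congr_ae ?_
    filter_upwards [hN.ae_exists_le hc, hN.ae_strictMono_arrivalTime hc] with ω hfin hmono
    exact gridDiscount_mul_stoppedValue hfin hmono (hι ω) r n k (putPayoff K) x
  refine IsGreatest.csSup_eq ⟨?_, ?_⟩
  · have hst := isStoppingTime_firstExercise (ν := μ.map fun ω ↦ X (ξ ω) ω) hX hN
      (Real.exp_pos (-r / n)) hq1 hK k x
    refine ⟨_, ⟨hst, fun ω ↦ ⟨_, rfl⟩⟩, ?_⟩
    rw [hpay _ _ fun ω ↦ rfl]
    exact ((integral_indexed_payoff hX hN hc hXN hξ' hξX (Real.exp_pos _) hq1 hK hst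
      (fun ω ↦ rfl) k x).2 fun i hi ↦ by
        rw [stoppingLoss_firstExerciseIndex _ _ _ _ _ hi]).symm
  · rintro v ⟨τ, ⟨hst, hgrid⟩, rfl⟩
    choose ι hι using hgrid
    rw [hpay τ ι hι]
    exact (integral_indexed_payoff hX hN hc hXN hξ' hξX (Real.exp_pos _) hq1 hK hst hι k x).1

end gridValue

/-! ### Transfer to the Lévy process -/

theorem proposition4p3 {Ω : Type*} [MeasurableSpace Ω] (μ : Measure Ω) [IsProbabilityMeasure μ]
    (n : ℕ) (hn : 1 ≤ n) (r K : ℝ) (hr : 0 < r) (hK : 0 < K)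
    (X : ℝ≥0 → Ω → ℝ) (hX : IsLevyProcess X μ)
    (N : ℝ≥0 → Ω → ℕ) (hN : IsPoissonProcess N (n : ℝ≥0) μ)
    (hXN : IndepFun (fun ω t ↦ X t ω) (fun ω t ↦ N t ω) μ)
    (ξ : Ω → ℝ≥0) (hξ : HasLaw (fun ω ↦ (ξ ω : ℝ)) (expMeasure (n : ℝ)) μ)
    (hξX : IndepFun ξ (fun ω t ↦ X t ω) μ)
    (hneg : 0 < μ {ω | X 1 ω < 0}) :
    let f : ℝ → ℝ := putPayoff K
    let V : ℕ → ℝ → ℝ := gridValue μ X N hX.measurable hN.measurable r n f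
    let C : ℕ → ℝ → ℝ := fun k ↦ continuationValue μ X ξ r n (V k)
    ∃ b : ℕ → ℝ, b 0 = Real.log K ∧
      (0 < μ {ω | 0 < X 1 ω} → StrictAnti b) ∧
      (μ {ω | 0 < X 1 ω} = 0 → b 1 < b 0 ∧ ∀ k, 1 ≤ k → b k = b 1) ∧
      ∀ k : ℕ,
        (0 < μ {ω | 0 < X 1 ω} →
          IsUniqueZeroOn (fun z ↦ C k z - f z) (Iio (b k)) (b (k + 1))) ∧
        (μ {ω | 0 < X 1 ω} = 0 →
          IsUniqueZeroOn (fun z ↦ C k z - f z) (Iio (b 0)) (b (k + 1))) ∧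
        (∀ x, x ≤ b (k + 1) → V (k + 1) x = f x) ∧
        (∀ x, b (k + 1) < x → V (k + 1) x = C k x) ∧
        (∀ x, b (k + 1) < x → V k x < V (k + 1) x) := by
  intro f V C
  have hc : (0 : ℝ≥0) < n := by exact_mod_cast hn
  have hn' : (0 : ℝ) < n := by exact_mod_cast hn
  have hq1 : Real.exp (-r / n) < 1 :=
    Real.exp_lt_one_iff.2 (div_neg_of_neg_of_pos (neg_lt_zero.2 hr) hn')
  have hmeas := aemeasurable_eval_independent_time hX (aemeasurable_of_hasLaw_coe hξ)
  set ν := μ.map fun ω ↦ X (ξ ω) ω with hν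
  have hνp : IsProbabilityMeasure ν := Measure.isProbabilityMeasure_map hmeas
  have hV : V = walkValue ν (Real.exp (-r / n)) K :=
    funext fun k ↦ funext fun x ↦ gridValue_eq_walkValue hn hr hK hX hN hXN hξ hξX k x
  have hC : ∀ k z, C k z =
      Real.exp (-r / n) * ∫ u, walkValue ν (Real.exp (-r / n)) K k (z + u) ∂ν := by
    intro k z
    have hcont := continuous_walkValue (ν := ν) (Real.exp_pos (-r / n)) hq1 hK k
    simp only [C, continuationValue, hV]
    rw [hν, integral_map hmeas]
    exact (hcont.comp (continuous_const.add continuous_id)).aestronglyMeasurable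
  have htail : ∀ a, 0 < ν (Iio a) := fun a ↦ by
    obtain ⟨t, ht⟩ := hX.exists_measure_Iio_pos hneg a
    exact map_eval_pos hX hn' hξ hξX isOpen_Iio ht
  -- `X_0 = 0` lies in this open set almost surely, so time `0` suffices for `map_eval_pos`.
  have hsupp : ∀ δ, 0 < δ → 0 < ν (Ioi (-δ)) := fun δ hδ ↦ by
    refine map_eval_pos hX hn' hξ hξX isOpen_Ioi (t := 0) ?_
    have : ∀ᵐ ω ∂μ, X 0 ω ∈ Ioi (-δ) := by
      filter_upwards [hX.zero] with ω hω
      rw [hω, mem_Ioi]; linarith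
    have hfull : ({ω | X 0 ω ∈ Ioi (-δ)} : Set Ω) =ᵐ[μ] univ := eventuallyEq_univ.2 this
    rw [measure_congr hfull, measure_univ]
    exact one_pos
  have hpos : 0 < μ {ω | 0 < X 1 ω} → 0 < ν (Ioi 0) := fun h ↦
    map_eval_pos hX hn' hξ hξX isOpen_Ioi (t := 1) h
  have hzero : μ {ω | 0 < X 1 ω} = 0 → ν (Ioi 0) = 0 := fun h ↦ by
    rw [hν, Measure.map_apply_of_aemeasurable hmeas measurableSet_Ioi]
    refine (measure_eval_of_indepFun_path hX.measurable hX.rightContinuous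
      (aemeasurable_of_hasLaw_coe hξ) hξX measurableSet_Ioi).trans ?_
    simp only [hX.measure_Ioi_eq_zero h, lintegral_zero]
  obtain ⟨b, hb0, hanti, hconst, hb⟩ :=
    exists_exercise_boundaries (ν := ν) (Real.exp_pos (-r / n)) hq1 hK htail hsupp
  refine ⟨b, hb0, fun h ↦ hanti (hpos h), fun h ↦ hconst (hzero h), fun k ↦ ?_⟩
  obtain ⟨h1, h2, h3, h4, h5⟩ := hb k
  simp only [hC, hV]
  exact ⟨fun h ↦ h1 (hpos h), fun h ↦ h2 (hzero h), h3, h4, h5⟩
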